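/- Let $r\ge 1$. The $A_r$ $Q$-system for a family $(R_{\alpha,n})_{0\le\alpha\le r+1,\ n\in\mathbb Z}$ of elements of a field consists of the relations $$R_{\alpha,n+1}R_{\alpha,n-1}=R_{\alpha,n}^2+R_{\alpha+1,n}R_{\alpha-1,n}\qquad(1\le\alpha\le r,\ n\in\mathbb Z),\qquad R_{0,n}=R_{r+1,n}=1\quad(n\in\mathbb Z),$$ and its initial data are $\mathbf x_0=(R_{\alpha,0},R_{\alpha,1})_{1\le\alpha\le r}$. A solution is called non-vanishing if $R_{\alpha,n}\neq0$ for all $1\le\alpha\le r$, $n\in\mathbb Z$. Put $$y_{2\alpha-1}=\frac{R_{\alpha-1,0}R_{\alpha,1}}{R_{\alpha,0}R_{\alpha-1,1}}\ (1\le\alpha\le r+1),\qquad y_{2\alpha}=\frac{R_{\alpha-1,0}R_{\alpha+1,1}}{R_{\alpha,0}R_{\alpha,1}}\ (1\le\alpha\le r).$$ Let $\widetilde G_r$ be the graph with the $2r+2$ vertices $0,1,\dots,r+2$ and $2',3',\dots,r'$, and with the following edges, each taken in both orientations: $(0,1)$ with label $1$, $(k,k+1)$ with label $2k$ for $1\le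 k\le r$, $(k,k')$ with label $2k-1$ for $2\le k\le r$, and $(r+1,r+2)$ with label $2r+1$. An oriented edge has weight $1$ if it points away from the vertex $0$, and weight $y_j$ if it points towards $0$ and has label $j$. The weight of a path is the product of the weights of its steps, and the weight of a family of paths is the product of the weights of its members. For $1\le\alpha\le r$ and $n\ge\alpha-1$ let $\mathcal Z_{\alpha,n}$ be the sum of the weights of all families of $\alpha$ paths on $\widetilde G_r$, drawn in the plane with time as abscissa (one unit of time per step), the $i$-th of which starts at the vertex $0$ at time $2i-2$ and ends at the vertex $0$ at time $2n+2\alpha-2i$ ($i=1,\dots,\alpha$), such that no two paths are at the same vertex at the same time. Then: (a) There is a solution of the $Q$-system, in the field of rational functions in $2r$ variables, whose initial data are the $2r$ variables; and every solution, in any field, whose initial data are algebraically independent over $\mathbb Z$ is non-vanishing. (b) There are exponent vectors in $\mathbb Z^{2r}$ and Laurent polynomials $P_{\alpha,n}$ in $2r$ variables with non-negative integer coefficients ($1\le\alpha\le r$, $n\in\mathbb Z$), depending only on $r$, such that for every field and every non-vanishing solution of the $Q$-system in it: 1. each weight $y_j$, $1\le j\le 2r+1$, is the Laurent monomial in $\mathbf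 x_0$ with the $j$-th of these exponent vectors; 2. $R_{\alpha,n}=(R_{1,0})^{\alpha}\,\mathcal Z_{\alpha,n}$ for all $1\le\alpha\le r$ and all $n\ge\alpha-1$; 3. $R_{\alpha,n}=P_{\alpha,n}(\mathbf x_0)$ for all $1\le\alpha\le r$ and all $n\in\mathbb Z$. -/

import Mathlib

namespace QSystem

/-- The `A_r` `Q`-system for a family `R α n` (`0 ≤ α ≤ r + 1`, `n ∈ ℤ`), with its boundary
conditions. Values of `R α` for `α > r + 1` play no role. -/
structure IsSolution {K : Type*} [Field K] (r : ℕ) (R : ℕ → ℤ → K) : Prop where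
  rel : ∀ α : ℕ, 1 ≤ α → α ≤ r → ∀ n : ℤ,
    R α (n + 1) * R α (n - 1) = R α n ^ 2 + R (α + 1) n * R (α - 1) n
  left : ∀ n : ℤ, R 0 n = 1
  right : ∀ n : ℤ, R (r + 1) n = 1

/-- All the variables `R α n`, `1 ≤ α ≤ r`, are nonzero, so that the recursion determines them
from the initial data. -/
def NonVanishing {K : Type*} [Field K] (r : ℕ) (R : ℕ → ℤ → K) : Prop :=
  ∀ α : ℕ, 1 ≤ α → α ≤ r → ∀ n : ℤ, R α n ≠ 0

/-- Labels of the `2r` initial variables: `(i, k)` stands for `R_{i+1, k}`, `k = 0, 1`. -/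
abbrev InitVar (r : ℕ) : Type := Fin r × Fin 2

/-- The initial data `(R_{α,0}, R_{α,1})`, `1 ≤ α ≤ r`. -/
def initialData {K : Type*} (r : ℕ) (R : ℕ → ℤ → K) (v : InitVar r) : K :=
  R ((v.1 : ℕ) + 1) ((v.2 : ℕ) : ℤ)

/-- The Laurent monomial with exponent vector `m`, evaluated at `x`. -/
def laurentMonomial {K : Type*} [Field K] {ι : Type*} [Fintype ι] (m : ι → ℤ) (x : ι → K) : K :=
  ∏ v, x v ^ m v

/-- Laurent polynomials with non-negative integer coefficients in variables indexed by `ι`: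
finitely supported functions from exponent vectors to coefficients. -/
abbrev PosLaurent (ι : Type*) : Type _ := (ι → ℤ) →₀ ℕ

/-- Evaluation of such a Laurent polynomial at `x`. -/
def PosLaurent.eval {K : Type*} [Field K] {ι : Type*} [Fintype ι]
    (P : PosLaurent ι) (x : ι → K) : K :=
  P.sum fun m c => (c : K) * laurentMonomial m x

/-- The weights `y_j`, `1 ≤ j ≤ 2r + 1`:
`y_{2α-1} = R_{α-1,0} R_{α,1} / (R_{α,0} R_{α-1,1})` for `1 ≤ α ≤ r + 1` and
`y_{2α} = R_{α-1,0} R_{α+1,1} / (R_{α,0} R_{α,1})` for `1 ≤ α ≤ r`. -/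
def weight {K : Type*} [Field K] (R : ℕ → ℤ → K) (j : ℕ) : K :=
  if j % 2 = 1 then
    R ((j - 1) / 2) 0 * R ((j + 1) / 2) 1 / (R ((j + 1) / 2) 0 * R ((j - 1) / 2) 1)
  else
    R (j / 2 - 1) 0 * R (j / 2 + 1) 1 / (R (j / 2) 0 * R (j / 2) 1)

/-- The `2r + 2` vertices of `G̃_r`: `Sum.inl k` is the vertex `k`, `0 ≤ k ≤ r + 2`, and
`Sum.inr k` is the vertex `(k + 2)'`, where `2 ≤ k + 2 ≤ r`. -/
abbrev Vertex (r : ℕ) : Type := Fin (r + 3) ⊕ Fin (r - 1)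

/-- The oriented edges of `G̃_r`: both orientations of `(k, k + 1)`, `0 ≤ k ≤ r + 1`, and of
`(k, k')`, `2 ≤ k ≤ r`. -/
def Arrow (r : ℕ) : Vertex r → Vertex r → Prop
  | Sum.inl a, Sum.inl b => (b : ℕ) = a + 1 ∨ (a : ℕ) = b + 1
  | Sum.inl a, Sum.inr b => (a : ℕ) = b + 2
  | Sum.inr a, Sum.inl b => (b : ℕ) = a + 2
  | Sum.inr _, Sum.inr _ => False

/-- The label of the edge `(k, k + 1)` of `G̃_r`: `1` for `k = 0`, `2k` for `1 ≤ k ≤ r`, and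
`2r + 1` for `k = r + 1`. -/
def chainLabel (r k : ℕ) : ℕ :=
  if k = 0 then 1 else if k ≤ r then 2 * k else 2 * r + 1

/-- The weight of an oriented edge of `G̃_r` (meaningful on arrows only): `1` for an edge pointing
away from the vertex `0`, and `y_j` for the edge labelled `j` pointing towards `0`; the label of
`(k, k')` is `2k - 1`. -/
def edgeWeight {K : Type*} [Field K] (r : ℕ) (y : ℕ → K) : Vertex r → Vertex r → K
  | Sum.inl a, Sum.inl b => if (a : ℕ) < b then 1 else y (chainLabel r b)
  | Sum.inl _, Sum.inr _ => 1
  | Sum.inr a, Sum.inl _ => y (2 * ((a : ℕ) + 2) - 1)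
  | Sum.inr _, Sum.inr _ => 1

/-- `p` is a path with `ℓ` steps on `G̃_r` from the vertex `0` to itself. -/
def IsPath (r ℓ : ℕ) (p : Fin (ℓ + 1) → Vertex r) : Prop :=
  p 0 = Sum.inl 0 ∧ p (Fin.last ℓ) = Sum.inl 0 ∧ ∀ i : Fin ℓ, Arrow r (p i.castSucc) (p i.succ)

/-- The weight of a path: the product of the weights of its steps. -/
def pathWeight {K : Type*} [Field K] (r : ℕ) (y : ℕ → K) {ℓ : ℕ} (p : Fin (ℓ + 1) → Vertex r) : K :=
  ∏ i : Fin ℓ, edgeWeight r y (p i.castSucc) (p i.succ)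

/-- Families of `α` non-intersecting paths on `G̃_r`, drawn in the plane with time as abscissa, the
`i`-th one going from `(s i, 0)` to `(e i, 0)`: `p i a` is the vertex that the `i`-th path visits at
time `s i + a`, and no two paths visit the same vertex at the same time. (Two paths that are both at
`k'` at a time were both at `k` one time unit earlier, so it makes no difference whether the
midpoints `k'` of the horizontal steps count as points of the paths.) -/
def IsNonIntersectingFamily (r : ℕ) {α : ℕ} (s e : Fin α → ℕ)
    (p : ∀ i : Fin α, Fin (e i - s i + 1) → Vertex r) : Prop :=
  (∀ i, s i ≤ e i) ∧ (∀ i, IsPath r (e i - s i) (p i)) ∧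
    ∀ i j, i ≠ j → ∀ (a : Fin (e i - s i + 1)) (b : Fin (e j - s j + 1)),
      s i + (a : ℕ) = s j + (b : ℕ) → p i a ≠ p j b

open Classical in
/-- The partition function of families of `α` non-intersecting weighted paths on `G̃_r`. -/
noncomputable def pathPartition {K : Type*} [Field K] (r : ℕ) (y : ℕ → K) {α : ℕ}
    (s e : Fin α → ℕ) : K :=
  ∑ p : (∀ i : Fin α, Fin (e i - s i + 1) → Vertex r) with IsNonIntersectingFamily r s e p,
    ∏ i, pathWeight r y (p i)

/-- Starting abscissas `2i - 2`, `i = 1, …, α` (here `i` counts from `0`). -/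
def startTime (α : ℕ) (i : Fin α) : ℕ := 2 * ((i : ℕ) + 1) - 2

/-- Ending abscissas `2n + 2α - 2i`, `i = 1, …, α` (here `i` counts from `0`). -/
def endTime (n α : ℕ) (i : Fin α) : ℕ := 2 * n + 2 * α - 2 * ((i : ℕ) + 1)

end QSystem

/-! The proof reduces everything to the first row, counts that row by walks, and returns to the
other rows through determinants. By the Desnanot–Jacobi identity the Hankel determinants of any
sequence satisfy the relations of the `Q`-system, with the empty determinant `1` as row `0`. As a
non-vanishing solution determines row `α + 1` from rows `α` and `α - 1`, it satisfies `R α n = det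
(R 1 (n - α + 1 + i + j))` (`IsSolution.eq_hankelDet`).

For the first row, `R 1 n / R 1 0` is the weight of all closed walks of `2 n` steps at the vertex
`0`. This goes by induction on `n` over all solutions at once: a translation of time by one changes
the weights `y`, and the relations of the `Q`-system say exactly that the new weights count walks
with two steps fewer, up to the factor `y 1 = R 1 1 / R 1 0` (`WalkRec.shift`,
`IsSolution.chainWalk_shift`). The Hankel determinant of these walk counts is then a
Lindström–Gessel–Viennot determinant. A tail attached at `0` makes all paths start and end
simultaneously, and then the determinant and the sum over disjoint walks obey the same one-step
recursion (`det_transferProd_eq_disjointWalkSum`).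

Every `y j` is a Laurent monomial, so each family of paths contributes one monomial with coefficient
`1`; this is positivity for `n ≥ α - 1`. For `0 ≤ n < α - 1` the value `R α n` does not feel the
left boundary, so it is also computed by the system of rank `r - k` with `k = α - n - 1`, where its
index `(n + 1, n)` lies in the range already treated. The solution of that smaller system with the
given data may fail to exist or may vanish somewhere, so the generic solution is used and
specialized. Negative `n` follow by the symmetry `n ↦ 1 - n`.

The generic solution exists and never vanishes because the recursion is free of subtractions:
setting all initial variables to `1` turns every term into a positive rational number
(`exists_pos_specializes`). -/

namespace QSystem

open Matrix

/-! ### Desnanot–Jacobi identity and Hankel determinants -/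

section Determinants

/-- The determinant of the identity matrix with two columns replaced. -/
theorem det_one_updateCol_updateCol {ι A : Type*} [Fintype ι] [DecidableEq ι] [CommRing A]
    {a b : ι} (hab : a ≠ b) (u v : ι → A) :
    (((1 : Matrix ι ι A).updateCol a u).updateCol b v).det = u a * v b - v a * u b := by
  -- The matrix is the identity plus a perturbation `U * V` of rank two, so its determinant is that
  -- of the `2 × 2` matrix `1 + V * U`.
  let U : Matrix ι (Fin 2) A := Matrix.of fun i j =>
    if j = 0 then u i - (1 : Matrix ι ι A) i a else v i - (1 : Matrix ι ι A) i b
  let V : Matrix (Fin 2) ι A := Matrix.of fun j i =>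
    if j = 0 then (1 : Matrix ι ι A) a i else (1 : Matrix ι ι A) b i
  have h : ((1 : Matrix ι ι A).updateCol a u).updateCol b v = 1 + U * V := by
    ext i j
    simp only [Matrix.add_apply, Matrix.mul_apply, Fin.sum_univ_two, U, V, Matrix.of_apply,
      Matrix.updateCol_apply]
    by_cases h1 : j = b
    · subst h1
      simp [Matrix.one_apply, hab]
    · by_cases h2 : j = a
      · subst h2
        simp [Matrix.one_apply, h1, Ne.symm hab]
      · simp [h1, h2, Matrix.one_apply, Ne.symm h1, Ne.symm h2]
  rw [h, Matrix.det_one_add_mul_comm, Matrix.det_fin_two]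
  simp [Matrix.mul_apply, U, V, Matrix.one_apply, hab, Ne.symm hab]

/-- Multiplying `M` by the identity matrix with its first and last columns replaced by those of the
adjugate gives `M` with these two columns replaced by multiples of unit vectors by `det M`; then
determinants are compared. A superfluous factor `det M` stays on both sides until it is cancelled
for the generic matrix. -/
theorem desnanot_jacobi_mul_det {A : Type*} [CommRing A] {m : ℕ}
    (M : Matrix (Fin (m + 2)) (Fin (m + 2)) A) :
    M.det * (M.adjugate 0 0 * M.adjugate (Fin.last _) (Fin.last _)
      - M.adjugate 0 (Fin.last _) * M.adjugate (Fin.last _) 0) =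
    M.det * (M.det * (M.submatrix (fun i : Fin m => i.castSucc.succ)
      (fun i : Fin m => i.castSucc.succ)).det) := by
  have h0l : (0 : Fin (m + 2)) ≠ Fin.last _ := (Fin.last_pos).ne
  have hB := det_one_updateCol_updateCol h0l (fun i => M.adjugate i 0)
    (fun i => M.adjugate i (Fin.last _))
  rw [← hB, ← Matrix.det_mul]
  have hprod : M * (((1 : Matrix _ _ A).updateCol 0 (fun i => M.adjugate i 0)).updateCol
      (Fin.last _) (fun i => M.adjugate i (Fin.last _))) =
      (M.updateCol 0 (M.det • Pi.single 0 1)).updateCol (Fin.last _)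
        (M.det • Pi.single (Fin.last _) 1) := by
    have key : ∀ j, (M *ᵥ fun i => M.adjugate i j) = M.det • Pi.single j 1 := by
      intro j
      ext i
      have := congrFun (congrFun (Matrix.mul_adjugate M) i) j
      rw [Matrix.mul_apply] at this
      simpa [Matrix.mulVec, dotProduct, Matrix.one_apply, Pi.single_apply] using this
    ext i j
    by_cases h1 : j = Fin.last _
    · subst h1
      simpa [Matrix.mul_apply, Matrix.mulVec, dotProduct] using congrFun (key (Fin.last _)) i
    · by_cases h2 : j = 0
      · subst h2
        simpa [Matrix.mul_apply, Matrix.mulVec, dotProduct, h1] using congrFun (key 0) i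
      · simp [Matrix.mul_apply, h1, h2, Matrix.one_apply]
  rw [hprod, Matrix.det_succ_column_zero, Finset.sum_eq_single 0]
  · rw [Matrix.det_succ_column _ (Fin.last m), Finset.sum_eq_single (Fin.last m)]
    · simp only [Matrix.submatrix_submatrix]
      have : (((M.updateCol 0 (M.det • Pi.single 0 1)).updateCol (Fin.last _)
        (M.det • Pi.single (Fin.last _) 1)).submatrix
          (Fin.succAbove 0 ∘ (Fin.last m).succAbove) (Fin.succ ∘ (Fin.last m).succAbove)) =
          M.submatrix (fun i : Fin m => i.castSucc.succ) (fun i : Fin m => i.castSucc.succ) := by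
        ext i j
        simp [Fin.ext_iff, j.2.ne]
      rw [this]
      simp [Fin.ext_iff, ← two_mul, pow_mul]
    · intro i _ hi
      have : (i : ℕ) ≠ m := fun h => hi (Fin.ext h)
      simp [Fin.ext_iff, this]
    · simp
  · intro i _ hi
    simp [hi, h0l]
  · simp

/-- The Desnanot–Jacobi identity, in terms of the adjugate. -/
theorem desnanot_jacobi_adjugate {A : Type*} [CommRing A] {m : ℕ}
    (M : Matrix (Fin (m + 2)) (Fin (m + 2)) A) :
    M.adjugate 0 0 * M.adjugate (Fin.last _) (Fin.last _)
      - M.adjugate 0 (Fin.last _) * M.adjugate (Fin.last _) 0 =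
    M.det * (M.submatrix (fun i : Fin m => i.castSucc.succ)
      (fun i : Fin m => i.castSucc.succ)).det := by
  -- For the matrix of indeterminates the determinant is a nonzero element of a domain and cancels;
  -- the identity then specializes to any commutative ring.
  let X := Matrix.mvPolynomialX (Fin (m + 2)) (Fin (m + 2)) ℤ
  have hX := mul_left_cancel₀ (Matrix.det_mvPolynomialX_ne_zero (Fin (m + 2)) ℤ)
    (desnanot_jacobi_mul_det X)
  let f := (MvPolynomial.aeval fun p : Fin (m + 2) × Fin (m + 2) => M p.1 p.2 :
    MvPolynomial (Fin (m + 2) × Fin (m + 2)) ℤ →ₐ[ℤ] A).toRingHom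
  have hf : f.mapMatrix X = M := Matrix.mvPolynomialX_mapMatrix_aeval ℤ M
  have hadj : ∀ i j, f (X.adjugate i j) = M.adjugate i j := by
    intro i j
    have := congrFun (congrFun (f.map_adjugate X) i) j
    rwa [hf] at this
  have := congrArg f hX
  rw [map_sub, map_mul, map_mul, map_mul, hadj, hadj, hadj, hadj, RingHom.map_det, RingHom.map_det,
    hf] at this
  rw [this, ← hf]
  rfl

/-- The Desnanot–Jacobi identity. -/
theorem desnanot_jacobi {A : Type*} [CommRing A] {m : ℕ}
    (M : Matrix (Fin (m + 2)) (Fin (m + 2)) A) :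
    (M.submatrix Fin.succ Fin.succ).det * (M.submatrix Fin.castSucc Fin.castSucc).det
      - (M.submatrix Fin.castSucc Fin.succ).det * (M.submatrix Fin.succ Fin.castSucc).det =
    M.det * (M.submatrix (fun i : Fin m => i.castSucc.succ)
      (fun i : Fin m => i.castSucc.succ)).det := by
  rw [← desnanot_jacobi_adjugate]
  simp only [Matrix.adjugate_fin_succ_eq_det_submatrix, Fin.succAbove_zero, Fin.succAbove_last]
  have h : ((-1 : A) ^ (m + 1)) * (-1) ^ (m + 1) = 1 := by
    rw [← mul_pow]; simp
  simp only [Fin.val_zero, Fin.val_last, add_zero, zero_add, pow_zero, one_mul, pow_add]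
  simp only [pow_add] at h
  linear_combination ((M.submatrix Fin.castSucc Fin.succ).det *
    (M.submatrix Fin.succ Fin.castSucc).det -
    (M.submatrix Fin.succ Fin.succ).det * (M.submatrix Fin.castSucc Fin.castSucc).det) * h

/-- The Hankel determinant `det (u (n - α + 1 + i + j))`, `0 ≤ i, j < α`. -/
noncomputable def hankelDet {A : Type*} [CommRing A] (u : ℤ → A) (α : ℕ) (n : ℤ) : A :=
  (Matrix.of fun i j : Fin α => u (n - α + 1 + (i : ℕ) + (j : ℕ))).det

theorem hankelDet_zero {A : Type*} [CommRing A] (u : ℤ → A) (n : ℤ) : hankelDet u 0 n = 1 := by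
  simp [hankelDet]

theorem hankelDet_one {A : Type*} [CommRing A] (u : ℤ → A) (n : ℤ) : hankelDet u 1 n = u n := by
  simp [hankelDet]

/-- Deleting the first or last row and column of a Hankel matrix leaves a Hankel matrix with shifted
index. The two mixed minors coincide, which produces the square. -/
theorem hankelDet_rel {A : Type*} [CommRing A] (u : ℤ → A) (α : ℕ) (n : ℤ) :
    hankelDet u (α + 1) (n + 1) * hankelDet u (α + 1) (n - 1) =
      hankelDet u (α + 1) n ^ 2 + hankelDet u (α + 2) n * hankelDet u α n := by
  have h := desnanot_jacobi
    (Matrix.of fun i j : Fin (α + 2) => u (n - (α + 2 : ℕ) + 1 + (i : ℕ) + (j : ℕ)))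
  have key : ∀ {k : ℕ} (f g : Fin k → Fin (α + 2)) (m : ℤ),
      (∀ i j, (n - (α + 2 : ℕ) + 1 + (f i : ℕ) + (g j : ℕ) : ℤ) = m - k + 1 + (i : ℕ) + (j : ℕ)) →
      ((Matrix.of fun i j : Fin (α + 2) =>
        u (n - (α + 2 : ℕ) + 1 + (i : ℕ) + (j : ℕ))).submatrix f g).det = hankelDet u k m := by
    intro k f g m hfg
    rw [hankelDet]
    congr 1
    ext i j
    simp only [Matrix.submatrix_apply, Matrix.of_apply]
    rw [hfg]
  rw [key _ _ (n + 1) (by intro i j; push_cast [Fin.val_succ]; ring),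
    key _ _ (n - 1) (by intro i j; push_cast [Fin.val_castSucc]; ring),
    key _ _ n (by intro i j; push_cast [Fin.val_succ, Fin.val_castSucc]; ring),
    key _ _ n (by intro i j; push_cast [Fin.val_succ, Fin.val_castSucc]; ring),
    key _ _ n (by intro i j; push_cast [Fin.val_succ, Fin.val_castSucc]; ring)] at h
  have h2 : (Matrix.of fun i j : Fin (α + 2) =>
      u (n - (α + 2 : ℕ) + 1 + (i : ℕ) + (j : ℕ))).det = hankelDet u (α + 2) n := rfl
  rw [h2] at h
  linear_combination h

end Determinants

/-- A non-vanishing solution is given by the Hankel determinants of its first row. -/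
theorem IsSolution.eq_hankelDet {K : Type*} [Field K] {r : ℕ} {R : ℕ → ℤ → K}
    (hR : IsSolution r R) (hnv : NonVanishing r R) (α : ℕ) :
    (α ≤ r + 1 → ∀ n, R α n = hankelDet (R 1) α n) ∧
      (α + 1 ≤ r + 1 → ∀ n, R (α + 1) n = hankelDet (R 1) (α + 1) n) := by
  induction α with
  | zero => exact ⟨fun _ n => by rw [hR.left, hankelDet_zero], fun _ n => (hankelDet_one _ _).symm⟩
  | succ α ih =>
    refine ⟨ih.2, fun hα n => ?_⟩
    have h1 := ih.1 (by omega)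
    have h2 := ih.2 (by omega)
    -- Given rows `α` and `α + 1`, the relation and its determinantal analogue differ only in the
    -- entry of row `α + 2`, whose coefficient is `R α n`.
    have hne : R α n ≠ 0 := by
      rcases Nat.eq_zero_or_pos α with rfl | hpos
      · simp [hR.left]
      · exact hnv α hpos (by omega) n
    have hrel := hR.rel (α + 1) (by omega) (by omega) n
    have hdet := hankelDet_rel (R 1) α n
    simp only [add_tsub_cancel_right] at hrel
    rw [← h2, ← h2, ← h2, ← h1] at hdet
    exact mul_right_cancel₀ hne (by linear_combination hdet - hrel)

/-! ### Transfer matrices and a Lindström–Gessel–Viennot formula -/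

section Transfer

variable {K S : Type*} [Field K] [Fintype S] [DecidableEq S]

/-- The product `T t * T (t + 1) * ⋯ * T (t + L - 1)` of transfer matrices. -/
def transferProd (T : ℕ → Matrix S S K) : ℕ → ℕ → Matrix S S K
  | _, 0 => 1
  | t, L + 1 => T t * transferProd T (t + 1) L

open Classical in
/-- The weighted sum of all families of walks from `v` at time `t` to `b` at time `t + L`,
whose positions are pairwise distinct at every time. -/
noncomputable def disjointWalkSum {α : ℕ} (T : ℕ → Matrix S S K) (b : Fin α → S)
    (t L : ℕ) (v : Fin α → S) : K :=
  ∑ q : Fin (L + 1) → Fin α → S,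
    if q 0 = v ∧ q (Fin.last L) = b ∧ ∀ s, Function.Injective (q s) then
      ∏ s : Fin L, ∏ i, T (t + s) (q s.castSucc i) (q s.succ i) else 0

theorem disjointWalkSum_succ {α : ℕ} (T : ℕ → Matrix S S K) (b : Fin α → S)
    (t L : ℕ) (v : Fin α → S) (hv : Function.Injective v) :
    disjointWalkSum T b t (L + 1) v =
      ∑ w : Fin α → S, (∏ i, T t (v i) (w i)) * disjointWalkSum T b (t + 1) L w := by
  classical
  unfold disjointWalkSum
  rw [← (Fin.consEquiv fun _ => Fin α → S).sum_comp, Fintype.sum_prod_type,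
    Finset.sum_eq_single v _ (by simp)]
  · simp_rw [Finset.mul_sum]
    rw [Finset.sum_comm]
    refine Finset.sum_congr rfl fun q _ => ?_
    rw [Finset.sum_eq_single (q 0) _ (by simp)]
    · have hl : (Fin.cons v q : Fin (L + 2) → Fin α → S) (Fin.last (L + 1)) = q (Fin.last L) := by
        rw [← Fin.succ_last, Fin.cons_succ]
      have hinj : (∀ s, Function.Injective ((Fin.cons v q : Fin (L + 2) → Fin α → S) s)) ↔
          ∀ s, Function.Injective (q s) := by
        rw [Fin.forall_fin_succ]
        simp [hv]
      simp only [Fin.consEquiv_apply, Fin.cons_zero, hl, hinj, true_and, mul_ite, mul_zero]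
      refine if_congr Iff.rfl ?_ rfl
      rw [Fin.prod_univ_succ]
      refine congrArg₂ _ rfl (Finset.prod_congr rfl fun s _ => ?_)
      rw [← Fin.succ_castSucc, Fin.cons_succ, Fin.cons_succ, Fin.val_succ, add_right_comm,
        add_assoc]
    · intro w _ hw
      rw [if_neg (fun h => hw h.1.symm), mul_zero]
  · intro w _ hw
    refine Finset.sum_eq_zero fun q _ => if_neg fun h => hw ?_
    simpa using h.1

/-- Each row on the left is a linear combination of rows for one step fewer, so multilinearity of
the determinant gives the sum. The recursion is that of `disjointWalkSum_succ`, which makes an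
induction on the number of steps possible. -/
theorem det_transferProd_succ {α : ℕ} (T : ℕ → Matrix S S K) (b v : Fin α → S) (t L : ℕ) :
    (Matrix.of fun i j => transferProd T t (L + 1) (v i) (b j)).det =
      ∑ w : Fin α → S, (∏ i, T t (v i) (w i)) *
        (Matrix.of fun i j => transferProd T (t + 1) L (w i) (b j)).det := by
  have h := (Matrix.detRowAlternating (n := Fin α) (R := K)).toMultilinearMap.map_sum
    (fun i (s : S) => T t (v i) s • fun j => transferProd T (t + 1) L s (b j))
  have hl : (fun i => ∑ s : S, T t (v i) s • fun j => transferProd T (t + 1) L s (b j)) =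
      Matrix.of fun i j => transferProd T t (L + 1) (v i) (b j) := by
    ext i j
    simp [transferProd, Matrix.mul_apply, Finset.sum_apply]
  rw [hl] at h
  refine Eq.trans h (Finset.sum_congr rfl fun w _ => ?_)
  exact (Matrix.detRowAlternating (n := Fin α) (R := K)).toMultilinearMap.map_smul_univ
    (fun i => T t (v i) (w i)) (fun i j => transferProd T (t + 1) L (w i) (b j))

/-- A Lindström–Gessel–Viennot formula: `Good` is a class of configurations that disjoint walks
cannot leave and in which the only permutation of the endpoint is the endpoint itself. -/
theorem det_transferProd_eq_disjointWalkSum {α : ℕ} (T : ℕ → Matrix S S K) (b : Fin α → S)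
    (Good : (Fin α → S) → Prop) (hinj : ∀ v, Good v → Function.Injective v)
    (hstep : ∀ t v w, Good v → (∀ i, T t (v i) (w i) ≠ 0) → Function.Injective w → Good w)
    (hend : ∀ w, Good w → (∀ i, ∃ j, w i = b j) → w = b) (hb : Function.Injective b) :
    ∀ (L t : ℕ) (v : Fin α → S), Good v →
      (Matrix.of fun i j => transferProd T t L (v i) (b j)).det = disjointWalkSum T b t L v := by
  classical
  intro L
  induction L with
  | zero =>
    intro t v hv
    have hsum : disjointWalkSum T b t 0 v = if v = b then 1 else 0 := by
      unfold disjointWalkSum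
      rw [Finset.sum_eq_single (fun _ => v) _ (by simp)]
      · simp [hinj v hv]
      · intro q _ hq
        refine if_neg fun h => hq ?_
        ext s : 1
        rw [show s = 0 from Fin.ext (by omega), h.1]
    rw [hsum]
    split_ifs with h
    · subst h
      have : (Matrix.of fun i j => transferProd T t 0 (v i) (v j)) = (1 : Matrix _ _ K) := by
        ext i j
        simp [transferProd, Matrix.one_apply, hb.eq_iff]
      rw [this, Matrix.det_one]
    · have : ∃ i, ∀ j, v i ≠ b j := by
        by_contra hcon
        push Not at hcon
        exact h (hend v hv hcon)
      obtain ⟨i, hi⟩ := this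
      exact Matrix.det_eq_zero_of_row_eq_zero i fun j => by simp [transferProd, hi j]
  | succ L ih =>
    intro t v hv
    rw [det_transferProd_succ, disjointWalkSum_succ _ _ _ _ _ (hinj v hv)]
    refine Finset.sum_congr rfl fun w _ => ?_
    by_cases hw : ∀ i, T t (v i) (w i) ≠ 0
    · by_cases hwi : Function.Injective w
      · rw [ih _ _ (hstep t v w hv hw hwi)]
      · have hdet : (Matrix.of fun i j => transferProd T (t + 1) L (w i) (b j)).det = 0 := by
          simp only [Function.Injective, not_forall] at hwi
          obtain ⟨i, j, hij, hne⟩ := hwi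
          exact Matrix.det_zero_of_row_eq hne (by ext k; simp [hij])
        have hsum : disjointWalkSum T b (t + 1) L w = 0 :=
          Finset.sum_eq_zero fun q _ => if_neg fun ⟨h0, _, hq⟩ => hwi (h0 ▸ hq 0)
        rw [hdet, hsum]
    · push Not at hw
      obtain ⟨i, hi⟩ := hw
      rw [Finset.prod_eq_zero (Finset.mem_univ i) hi, zero_mul, zero_mul]

end Transfer

/-! ### The graph with a tail, and its transfer matrices -/

section Extended

variable {K : Type*} [Field K] {r N : ℕ}

/-- The vertices of `G̃_r` together with a tail of `N` further vertices below the vertex `0`. -/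
abbrev ExtVertex (r N : ℕ) : Type := Vertex r ⊕ Fin N

/-- The vertex at distance `k` below `0` on the tail. -/
def tailPos (r N : ℕ) : ℕ → ExtVertex r N
  | 0 => Sum.inl (Sum.inl 0)
  -- Beyond the end of the tail the value is a dummy.
  | k + 1 => if h : k < N then Sum.inr ⟨k, h⟩ else Sum.inl (Sum.inl 0)

/-- The arrows of `G̃_r` with a tail that is traversed upwards only, or downwards only. -/
def ExtArrow (up : Prop) : ExtVertex r N → ExtVertex r N → Prop
  | Sum.inl a, Sum.inl b => Arrow r a b
  | Sum.inl a, Sum.inr k => ¬up ∧ a = Sum.inl 0 ∧ (k : ℕ) = 0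
  | Sum.inr k, Sum.inl b => up ∧ b = Sum.inl 0 ∧ (k : ℕ) = 0
  | Sum.inr k, Sum.inr l => (up ∧ (k : ℕ) = l + 1) ∨ (¬up ∧ (l : ℕ) = k + 1)

/-- The weights of the arrows; those on the tail have weight `1`. -/
def extWeight (y : ℕ → K) : ExtVertex r N → ExtVertex r N → K
  | Sum.inl a, Sum.inl b => edgeWeight r y a b
  | _, _ => 1

/-- The depth of a vertex: its signed distance from the vertex `0`. -/
def depth : ExtVertex r N → ℤ
  | Sum.inl (Sum.inl k) => (k : ℕ)
  -- The vertex is `(k + 2)'`, one step further from `0` than `k + 2`.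
  | Sum.inl (Sum.inr k) => (k : ℕ) + 3
  | Sum.inr k => -((k : ℕ) + 1)

/-- A height whose order is preserved by walks that do not meet. -/
def height : ExtVertex r N → ℤ
  | Sum.inl (Sum.inl k) => 2 * (k : ℕ)
  -- This is just below the height `2 * k + 6` of the chain vertex `k + 3` of the same depth.
  | Sum.inl (Sum.inr k) => 2 * (k : ℕ) + 5
  | Sum.inr k => -2 * ((k : ℕ) + 1)

theorem height_injective : Function.Injective (height : ExtVertex r N → ℤ) := by
  rintro ((a | a) | a) ((b | b) | b) h <;> simp only [height] at h <;>
    first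
    | (exfalso; omega)
    | (simp only [Sum.inl.injEq, Sum.inr.injEq, Fin.ext_iff]; omega)

theorem ExtArrow.depth_eq {up : Prop} {a b : ExtVertex r N} (h : ExtArrow up a b) :
    depth b = depth a + 1 ∨ depth b = depth a - 1 := by
  rcases a with (a | a) | a <;> rcases b with (b | b) | b <;>
    simp only [ExtArrow, Arrow, depth, Sum.inl.injEq, reduceCtorEq, false_and, and_false,
      Fin.ext_iff, Fin.val_zero] at h ⊢ <;> omega

/-- Height orders vertices by depth first. Depths of equal parity that differ do so by at least two,
so one step can at most equalize them; the upper walker then comes from greater depth and lands on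
the chain (or tail), not on a primed vertex, hence on the highest vertex of its depth. If the depths
agree, the lower walker is at a primed vertex, and its only move is towards `0`. -/
theorem ExtArrow.height_le {up : Prop} {a b a' b' : ExtVertex r N} (ha : ExtArrow up a a')
    (hb : ExtArrow up b b') (hpar : depth a % 2 = depth b % 2) (hlt : height b < height a) :
    height b' ≤ height a' := by
  rcases a with (a | a) | a <;> rcases b with (b | b) | b <;>
    rcases a' with (a' | a') | a' <;> rcases b' with (b' | b') | b' <;>
    simp only [ExtArrow, Arrow, depth, height, Sum.inl.injEq, reduceCtorEq, false_and, and_false,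
      Fin.ext_iff, Fin.val_zero] at ha hb hpar hlt ⊢ <;> omega

open Classical in
/-- The weighted adjacency matrix of `G̃_r`. -/
noncomputable def adjacency (r : ℕ) (y : ℕ → K) : Matrix (Vertex r) (Vertex r) K :=
  Matrix.of fun a b => if Arrow r a b then edgeWeight r y a b else 0

open Classical in
/-- The transfer matrix at time `t`: the tail is traversed upwards before time `M`, and downwards
from then on. -/
noncomputable def extMatrix (r N : ℕ) (y : ℕ → K) (M t : ℕ) :
    Matrix (ExtVertex r N) (ExtVertex r N) K :=
  Matrix.of fun a b => if ExtArrow (t < M) a b then extWeight y a b else 0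

theorem extArrow_of_extMatrix_ne_zero {y : ℕ → K} {M t : ℕ} {a b : ExtVertex r N}
    (h : extMatrix r N y M t a b ≠ 0) : ExtArrow (t < M) a b := by
  by_contra hcon
  exact h (by simp [extMatrix, hcon])

theorem tailPos_succ_of_lt {k : ℕ} (h : k < N) : tailPos r N (k + 1) = Sum.inr ⟨k, h⟩ := by
  simp [tailPos, h]

theorem depth_tailPos {k : ℕ} (h : k ≤ N) : depth (tailPos r N k) = -k := by
  cases k with
  | zero => simp [tailPos, depth]
  | succ k => rw [tailPos_succ_of_lt h]; simp [depth]

theorem height_tailPos {k : ℕ} (h : k ≤ N) : height (tailPos r N k) = -2 * k := by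
  cases k with
  | zero => simp [tailPos, height]
  | succ k => rw [tailPos_succ_of_lt h]; simp [height]

theorem ExtArrow.eq_tailPos_of_up {up : Prop} (hup : up) {k : ℕ} (hk : k < N) {x : ExtVertex r N}
    (h : ExtArrow up (tailPos r N (k + 1)) x) : x = tailPos r N k := by
  rw [tailPos_succ_of_lt hk] at h
  rcases x with x | x
  · obtain ⟨-, rfl, h0⟩ := h
    simp only at h0
    subst h0
    rfl
  · rcases h with h | h
    · have h2 := h.2
      simp only at h2
      subst h2
      rw [tailPos_succ_of_lt x.2]
    · exact absurd hup h.1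

theorem ExtArrow.eq_tailPos_of_down {up : Prop} (hup : ¬up) {k : ℕ} (hk : k < N)
    {x : ExtVertex r N} (h : ExtArrow up x (tailPos r N (k + 1))) : x = tailPos r N k := by
  rw [tailPos_succ_of_lt hk] at h
  rcases x with x | x
  · obtain ⟨-, rfl, h0⟩ := h
    simp only at h0
    subst h0
    rfl
  · rcases h with h | h
    · exact absurd h.1 hup
    · have h2 := h.2
      simp only at h2
      subst h2
      rw [tailPos_succ_of_lt x.2]

theorem extArrow_tailPos_up {up : Prop} (hup : up) {k : ℕ} (hk : k < N) :
    ExtArrow up (tailPos r N (k + 1)) (tailPos r N k) := by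
  rw [tailPos_succ_of_lt hk]
  cases k with
  | zero => exact ⟨hup, rfl, rfl⟩
  | succ k => rw [tailPos_succ_of_lt (by omega)]; exact Or.inl ⟨hup, rfl⟩

theorem extArrow_tailPos_down {up : Prop} (hup : ¬up) {k : ℕ} (hk : k < N) :
    ExtArrow up (tailPos r N k) (tailPos r N (k + 1)) := by
  rw [tailPos_succ_of_lt hk]
  cases k with
  | zero => exact ⟨hup, rfl, rfl⟩
  | succ k => rw [tailPos_succ_of_lt (by omega)]; exact Or.inr ⟨hup, rfl⟩

theorem extWeight_tailPos_left (y : ℕ → K) {k : ℕ} (hk : k < N) (x : ExtVertex r N) :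
    extWeight y (tailPos r N (k + 1)) x = 1 := by
  rw [tailPos_succ_of_lt hk]
  rfl

theorem extWeight_tailPos_right (y : ℕ → K) {k : ℕ} (hk : k < N) (x : ExtVertex r N) :
    extWeight y x (tailPos r N (k + 1)) = 1 := by
  rw [tailPos_succ_of_lt hk]
  rcases x with x | x <;> rfl

theorem extMatrix_inl_inl (y : ℕ → K) (M t : ℕ) (a b : Vertex r) :
    extMatrix r N y M t (Sum.inl a) (Sum.inl b) = adjacency r y a b := rfl

theorem extMatrix_inl_inr_up (y : ℕ → K) {M t : ℕ} (ht : t < M) (a : Vertex r) (k : Fin N) :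
    extMatrix r N y M t (Sum.inl a) (Sum.inr k) = 0 := by
  simp [extMatrix, ExtArrow, ht]

theorem extMatrix_inr_inl_down (y : ℕ → K) {M t : ℕ} (ht : M ≤ t) (a : Vertex r) (k : Fin N) :
    extMatrix r N y M t (Sum.inr k) (Sum.inl a) = 0 := by
  simp [extMatrix, ExtArrow, ht.not_gt]

theorem extMatrix_tailPos_up (y : ℕ → K) {M t k : ℕ} (ht : t < M) (hk : k < N)
    (x : ExtVertex r N) :
    extMatrix r N y M t (tailPos r N (k + 1)) x = if x = tailPos r N k then 1 else 0 := by
  split_ifs with h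
  · subst h
    simp [extMatrix, extArrow_tailPos_up ht hk, extWeight_tailPos_left y hk]
  · have : ¬ExtArrow (t < M) (tailPos r N (k + 1)) x := fun hx => h (hx.eq_tailPos_of_up ht hk)
    simp [extMatrix, this]

theorem extMatrix_inr_down (y : ℕ → K) {M t : ℕ} (ht : M ≤ t) (k l : Fin N) :
    extMatrix r N y M t (Sum.inr k) (Sum.inr l) = if (l : ℕ) = k + 1 then 1 else 0 := by
  simp [extMatrix, ExtArrow, ht.not_gt, extWeight]

theorem extMatrix_inl_inr_down (y : ℕ → K) {M t : ℕ} (ht : M ≤ t) (a : Vertex r) (k : Fin N) :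
    extMatrix r N y M t (Sum.inl a) (Sum.inr k) =
      if a = Sum.inl 0 ∧ (k : ℕ) = 0 then 1 else 0 := by
  simp [extMatrix, ExtArrow, ht.not_gt, extWeight]

/-- While the tail leads downwards, walks to the tail are walks to `0` that continue down. -/
theorem transferProd_down (y : ℕ → K) {M m : ℕ} (hm : m ≤ N) (L : ℕ) : ∀ t, M ≤ t →
    (∀ v, transferProd (extMatrix r N y M) t L (Sum.inl v) (tailPos r N m) =
      if m ≤ L then (adjacency r y ^ (L - m)) v (Sum.inl 0) else 0) ∧
    (∀ k : Fin N, transferProd (extMatrix r N y M) t L (Sum.inr k) (tailPos r N m) =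
      if (k : ℕ) + 1 + L = m then 1 else 0) := by
  induction L with
  | zero =>
    intro t _
    cases m with
    | zero => simp [transferProd, tailPos, Matrix.one_apply]
    | succ m =>
      rw [tailPos_succ_of_lt hm]
      simp [transferProd, Matrix.one_apply, Fin.ext_iff]
  | succ L ih =>
    intro t ht
    obtain ⟨ih1, ih2⟩ := ih (t + 1) (by omega)
    constructor
    · intro v
      simp only [transferProd, Matrix.mul_apply, Fintype.sum_sum_type (α₁ := Vertex r), ih1, ih2,
        extMatrix_inl_inl, extMatrix_inl_inr_down y ht]
      by_cases hmL : m ≤ L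
      · have h0 : ∑ x : Fin N, ((if v = Sum.inl 0 ∧ (x : ℕ) = 0 then 1 else 0) *
            if (x : ℕ) + 1 + L = m then (1 : K) else 0) = 0 :=
          Finset.sum_eq_zero fun x _ => by
            rw [if_neg (by omega : ¬(x : ℕ) + 1 + L = m), mul_zero]
        rw [h0, add_zero, if_pos (by omega), Nat.succ_sub hmL, pow_succ', Matrix.mul_apply]
        simp [hmL]
      · simp only [if_neg hmL, mul_zero, Finset.sum_const_zero, zero_add]
        split_ifs with hm1
        -- Only a walk that starts at `0` and goes straight down reaches distance `m` in `m` steps.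
        · have hm2 : m = L + 1 := by omega
          subst hm2
          rw [Finset.sum_eq_single ⟨0, by omega⟩ _ (by simp)]
          · simp [Matrix.one_apply, add_comm]
          · intro x _ hx
            rw [if_neg, zero_mul]
            exact fun h => hx (Fin.ext h.2)
        · refine Finset.sum_eq_zero fun x _ => ?_
          by_cases hx : (x : ℕ) = 0
          · rw [if_neg (by omega : ¬(x : ℕ) + 1 + L = m), mul_zero]
          · rw [if_neg (fun h => hx h.2), zero_mul]
    · intro k
      simp only [transferProd, Matrix.mul_apply, Fintype.sum_sum_type (α₁ := Vertex r), ih1, ih2,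
        extMatrix_inr_inl_down y ht, extMatrix_inr_down y ht, zero_mul, Finset.sum_const_zero,
        zero_add]
      split_ifs with hk
      · rw [Finset.sum_eq_single ⟨(k : ℕ) + 1, by omega⟩ _ (by simp)]
        · rw [if_pos rfl, if_pos (by simp only; omega), one_mul]
        · intro x _ hx
          rw [if_neg (fun h => hx (Fin.ext h)), zero_mul]
      · refine Finset.sum_eq_zero fun x _ => ?_
        by_cases hx : (x : ℕ) = k + 1
        · rw [if_neg (by omega : ¬(x : ℕ) + 1 + L = m), mul_zero]
        · rw [if_neg hx, zero_mul]

/-- Before time `M` no arrow leads from `G̃_r` into the tail, so these steps are powers of the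
adjacency matrix. -/
theorem transferProd_up (y : ℕ → K) {M m : ℕ} (hm : m ≤ N) (d : ℕ) : ∀ t L, t + d = M → d + m ≤ L →
    ∀ v, transferProd (extMatrix r N y M) t L (Sum.inl v) (tailPos r N m) =
      (adjacency r y ^ (L - m)) v (Sum.inl 0) := by
  induction d with
  | zero =>
    intro t L ht hL v
    rw [(transferProd_down y hm L t (by omega)).1 v, if_pos (by omega)]
  | succ d ih =>
    intro t L ht hL v
    obtain ⟨L, rfl⟩ : ∃ L', L = L' + 1 := ⟨L - 1, by omega⟩
    simp only [transferProd, Matrix.mul_apply, Fintype.sum_sum_type (α₁ := Vertex r),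
      extMatrix_inl_inl, extMatrix_inl_inr_up y (show t < M by omega), zero_mul,
      Finset.sum_const_zero, add_zero, ih (t + 1) L (by omega) (by omega)]
    rw [Nat.succ_sub (by omega), pow_succ', Matrix.mul_apply]

theorem transferProd_tail (y : ℕ → K) {M : ℕ} (k : ℕ) : ∀ t L, t + k ≤ M → k ≤ N → ∀ b,
    transferProd (extMatrix r N y M) t (L + k) (tailPos r N k) b =
      transferProd (extMatrix r N y M) (t + k) L (Sum.inl (Sum.inl 0)) b := by
  induction k with
  | zero => intro t L _ _ b; rfl
  | succ k ih =>
    intro t L ht hk b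
    rw [← add_assoc, transferProd, Matrix.mul_apply,
      Finset.sum_eq_single (tailPos r N k) _ (by simp)]
    · rw [extMatrix_tailPos_up y (by omega) hk, if_pos rfl, one_mul, ih _ _ (by omega) (by omega),
        add_right_comm, add_assoc]
    · intro x _ hx
      rw [extMatrix_tailPos_up y (by omega) hk, if_neg hx, zero_mul]

/-- The first `s` steps climb the tail and the last `T - e` steps descend it, all with weight `1`;
what remains is a free walk on `G̃_r` during `[s, e]`. -/
theorem transferProd_tail_tail (y : ℕ → K) {M s e T : ℕ} (hs : s ≤ M) (he : M ≤ e) (heT : e ≤ T)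
    (hsN : s ≤ N) (hTN : T - e ≤ N) :
    transferProd (extMatrix r N y M) 0 T (tailPos r N s) (tailPos r N (T - e)) =
      (adjacency r y ^ (e - s)) (Sum.inl 0) (Sum.inl 0) := by
  have h := transferProd_tail (M := M) y s 0 (T - s) (by omega) hsN (tailPos r N (T - e))
  rw [show T - s + s = T by omega, zero_add] at h
  rw [h, transferProd_up y hTN (M - s) s (T - s) (by omega) (by omega),
    show T - s - (T - e) = e - s by omega]

end Extended

/-! ### Families of paths as disjoint walks over a common time interval -/

section Families

variable {K : Type*} [Field K] {r N : ℕ}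

theorem exists_inl_of_extArrow_up {up : Prop} (hup : up) {v : Vertex r} {x : ExtVertex r N}
    (h : ExtArrow up (Sum.inl v) x) : ∃ w, x = Sum.inl w := by
  rcases x with x | x
  · exact ⟨x, rfl⟩
  · exact absurd hup h.1

theorem exists_inl_of_extArrow_down {up : Prop} (hup : ¬up) {v : Vertex r} {x : ExtVertex r N}
    (h : ExtArrow up x (Sum.inl v)) : ∃ w, x = Sum.inl w := by
  rcases x with x | x
  · exact ⟨x, rfl⟩
  · exact absurd h.1 hup

/-- A walk between the two ends of the tail climbs to `0`, stays in `G̃_r`, and goes down again. -/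
theorem walk_structure {M s e T : ℕ} (hs : s ≤ M) (he : M ≤ e) (heT : e ≤ T)
    (hsN : s ≤ N) (hTN : T - e ≤ N) {f : ℕ → ExtVertex r N} (h0 : f 0 = tailPos r N s)
    (hT : f T = tailPos r N (T - e)) (hf : ∀ t < T, ExtArrow (t < M) (f t) (f (t + 1))) :
    (∀ t ≤ s, f t = tailPos r N (s - t)) ∧ (∀ t, e ≤ t → t ≤ T → f t = tailPos r N (t - e)) ∧
      ∀ t, s ≤ t → t ≤ e → ∃ v, f t = Sum.inl v := by
  have h1 : ∀ t ≤ s, f t = tailPos r N (s - t) := by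
    intro t
    induction t with
    | zero => intro _; simpa using h0
    | succ t ih =>
      intro ht
      have := hf t (by omega)
      rw [ih (by omega), show s - t = s - (t + 1) + 1 by omega] at this
      exact this.eq_tailPos_of_up (by omega) (by omega)
  have h2 : ∀ j, j ≤ T - e → f (T - j) = tailPos r N (T - e - j) := by
    intro j
    induction j with
    | zero => intro _; simpa using hT
    | succ j ih =>
      intro hj
      have := hf (T - (j + 1)) (by omega)
      rw [show T - (j + 1) + 1 = T - j by omega, ih (by omega),
        show T - e - j = T - e - (j + 1) + 1 by omega] at this
      exact this.eq_tailPos_of_down (by omega) (by omega)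
  have h2' : ∀ t, e ≤ t → t ≤ T → f t = tailPos r N (t - e) := by
    intro t ht htT
    have := h2 (T - t) (by omega)
    rwa [show T - (T - t) = t by omega, show T - e - (T - t) = t - e by omega] at this
  have h3 : ∀ d, s + d ≤ M → ∃ v, f (s + d) = Sum.inl v := by
    intro d
    induction d with
    | zero => intro _; exact ⟨Sum.inl 0, by simpa [tailPos] using h1 s le_rfl⟩
    | succ d ih =>
      intro hd
      obtain ⟨v, hv⟩ := ih (by omega)
      have := hf (s + d) (by omega)
      rw [hv] at this
      exact exists_inl_of_extArrow_up (by omega) this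
  have h4 : ∀ d, M + d ≤ e → ∃ v, f (e - d) = Sum.inl v := by
    intro d
    induction d with
    | zero => intro _; exact ⟨Sum.inl 0, by simpa [tailPos] using h2' e le_rfl heT⟩
    | succ d ih =>
      intro hd
      obtain ⟨v, hv⟩ := ih (by omega)
      have := hf (e - (d + 1)) (by omega)
      rw [show e - (d + 1) + 1 = e - d by omega, hv] at this
      exact exists_inl_of_extArrow_down (by omega) this
  refine ⟨h1, h2', fun t hst hte => ?_⟩
  rcases le_total t M with h | h
  · simpa [show s + (t - s) = t by omega] using h3 (t - s) (by omega)
  · simpa [show e - (e - t) = t by omega] using h4 (e - t) (by omega)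

/-- The extension of a path by the tail. -/
def extendPath (N : ℕ) (s e : ℕ) (p : Fin (e - s + 1) → Vertex r) (t : ℕ) : ExtVertex r N :=
  -- With truncated subtraction and `s ≤ e`, exactly one of `s - t` and `t - e` is nonzero outside
  -- `[s, e]`.
  if h : s ≤ t ∧ t ≤ e then Sum.inl (p ⟨t - s, by omega⟩) else tailPos r N ((s - t) + (t - e))

theorem extendPath_add {s e : ℕ} (p : Fin (e - s + 1) → Vertex r) (hse : s ≤ e)
    (a : Fin (e - s + 1)) : extendPath N s e p (s + a) = Sum.inl (p a) := by
  have : s ≤ s + (a : ℕ) ∧ s + (a : ℕ) ≤ e := by omega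
  rw [extendPath, dif_pos this]
  congr 2
  exact Fin.ext (by simp)

theorem extendPath_of_le {s e t : ℕ} {p : Fin (e - s + 1) → Vertex r} (hse : s ≤ e)
    (hp : IsPath r (e - s) p) (ht : t ≤ s) : extendPath N s e p t = tailPos r N (s - t) := by
  rcases ht.eq_or_lt with rfl | ht
  · have := extendPath_add (N := N) p hse 0
    rw [hp.1] at this
    simpa [tailPos] using this
  · rw [extendPath, dif_neg (by omega), show t - e = 0 by omega, add_zero]

theorem extendPath_of_ge {s e t : ℕ} {p : Fin (e - s + 1) → Vertex r} (hse : s ≤ e)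
    (hp : IsPath r (e - s) p) (ht : e ≤ t) : extendPath N s e p t = tailPos r N (t - e) := by
  rcases ht.eq_or_lt with rfl | ht
  · have := extendPath_add (N := N) p hse (Fin.last _)
    rw [hp.2.1] at this
    simpa [tailPos, hse] using this
  · rw [extendPath, dif_neg (by omega), show s - t = 0 by omega, zero_add]

/-- The weight of the extended path is the weight of the path. -/
theorem prod_extMatrix_extendPath (y : ℕ → K) {M s e T : ℕ} (hs : s ≤ M) (he : M ≤ e)
    (heT : e ≤ T) (hsN : s ≤ N) (hTN : T - e ≤ N) {p : Fin (e - s + 1) → Vertex r}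
    (hp : IsPath r (e - s) p) :
    ∏ t : Fin T, extMatrix r N y M t (extendPath N s e p t) (extendPath N s e p (t + 1)) =
      pathWeight r y p := by
  have hse := hs.trans he
  symm
  refine Finset.prod_of_injOn (fun a : Fin (e - s) => (⟨s + a, by omega⟩ : Fin T)) ?_ (by simp)
    ?_ ?_
  · intro a _ b _ hab
    simp only [Fin.mk.injEq] at hab
    exact Fin.ext (by omega)
  · intro t _ ht
    have ht' : (t : ℕ) < s ∨ e ≤ t := by
      by_contra hcon
      refine ht ⟨⟨t - s, by omega⟩, by simp, Fin.ext ?_⟩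
      simp only
      omega
    rcases ht' with ht' | ht'
    · rw [extendPath_of_le hse hp (by omega), extendPath_of_le hse hp (by omega),
        show s - (t : ℕ) = s - (t + 1) + 1 by omega, extMatrix_tailPos_up y (by omega) (by omega),
        if_pos rfl]
    · rw [extendPath_of_ge hse hp ht', extendPath_of_ge hse hp (by omega),
        show (t : ℕ) + 1 - e = t - e + 1 by omega, extMatrix, Matrix.of_apply,
        if_pos (extArrow_tailPos_down (by omega) (by omega)),
        extWeight_tailPos_right y (by omega)]
  · intro a _
    have h1 := extendPath_add (N := N) p hse a.castSucc
    have h2 := extendPath_add (N := N) p hse a.succ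
    simp only [Fin.val_castSucc, Fin.val_succ, ← add_assoc] at h1 h2
    simp only [h1, h2, extMatrix_inl_inl, adjacency, Matrix.of_apply, if_pos (hp.2.2 a)]

/-- The path inside an extended walk. -/
def restrictWalk (s e : ℕ) (f : ℕ → ExtVertex r N) (a : Fin (e - s + 1)) : Vertex r :=
  (f (s + a)).elim id fun _ => Sum.inl 0

theorem extendPath_restrictWalk {M s e T : ℕ} (hs : s ≤ M) (he : M ≤ e) (heT : e ≤ T)
    (hsN : s ≤ N) (hTN : T - e ≤ N) {f : ℕ → ExtVertex r N} (h0 : f 0 = tailPos r N s)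
    (hT : f T = tailPos r N (T - e)) (hf : ∀ t < T, ExtArrow (t < M) (f t) (f (t + 1))) :
    IsPath r (e - s) (restrictWalk s e f) ∧
      ∀ t ≤ T, extendPath N s e (restrictWalk s e f) t = f t := by
  obtain ⟨h1, h2, h3⟩ := walk_structure hs he heT hsN hTN h0 hT hf
  have hin : ∀ a : Fin (e - s + 1), f (s + a) = Sum.inl (restrictWalk s e f a) := by
    intro a
    obtain ⟨v, hv⟩ := h3 (s + a) (by omega) (by omega)
    rw [restrictWalk, hv]
    rfl
  constructor
  · refine ⟨?_, ?_, fun i => ?_⟩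
    · have := hin 0
      simp only [Fin.val_zero, add_zero, h1 s le_rfl, Nat.sub_self] at this
      exact (Sum.inl.inj this).symm
    · have := hin (Fin.last _)
      rw [Fin.val_last, show s + (e - s) = e by omega, h2 e le_rfl heT, Nat.sub_self] at this
      exact (Sum.inl.inj this).symm
    · have := hf (s + i) (by omega)
      have ha := hin i.castSucc
      have hb := hin i.succ
      simp only [Fin.val_castSucc, Fin.val_succ, ← add_assoc] at ha hb
      rw [ha, hb] at this
      exact this
  · intro t ht
    rw [extendPath]
    split_ifs with h
    · rw [← hin]
      simp only
      congr 1
      omega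
    · rcases Nat.lt_or_ge t s with hts | hts
      · rw [h1 t hts.le, show t - e = 0 by omega, add_zero]
      · rw [h2 t (by omega) ht, show s - t = 0 by omega, zero_add]

/-- Families of non-intersecting paths are families of disjoint walks on the extended graph. -/
theorem pathPartition_eq_disjointWalkSum (y : ℕ → K) {α M T : ℕ} {s e : Fin α → ℕ}
    (hs : ∀ i, s i ≤ M) (he : ∀ i, M ≤ e i) (heT : ∀ i, e i ≤ T) (hsN : ∀ i, s i ≤ N)
    (hTN : ∀ i, T - e i ≤ N) (hsi : Function.Injective s) (hei : Function.Injective e) :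
    pathPartition r y s e =
      disjointWalkSum (extMatrix r N y M) (fun i => tailPos r N (T - e i)) 0 T
        (fun i => tailPos r N (s i)) := by
  classical
  have hse : ∀ i, s i ≤ e i := fun i => (hs i).trans (he i)
  unfold pathPartition disjointWalkSum
  -- Extension by the tail is injective and preserves weights, and walks outside its image
  -- contribute zero.
  refine Finset.sum_of_injOn
    (fun p (t : Fin (T + 1)) i => extendPath N (s i) (e i) (p i) t) ?_ (by simp) ?_ ?_
  · intro p _ p' _ hpp
    ext i a : 2
    have := congrFun (congrFun hpp ⟨s i + a, by have := heT i; have := hse i; omega⟩) i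
    simp only [extendPath_add _ (hse i)] at this
    exact Sum.inl.inj this
  · intro q _ hq
    by_contra hne
    rw [← ne_eq, ite_ne_right_iff] at hne
    obtain ⟨⟨hq0, hqT, hqi⟩, hprod⟩ := hne
    refine hq ?_
    have hstep : ∀ (t : Fin T) i, ExtArrow ((t : ℕ) < M) (q t.castSucc i) (q t.succ i) := by
      intro t i
      have h1 := Finset.prod_ne_zero_iff.1 hprod t (Finset.mem_univ _)
      have h2 := Finset.prod_ne_zero_iff.1 h1 i (Finset.mem_univ _)
      rw [zero_add] at h2
      exact extArrow_of_extMatrix_ne_zero h2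
    -- Times beyond `T` wrap around modulo `T + 1`; only `t ≤ T` is used.
    let f : Fin α → ℕ → ExtVertex r N := fun i t => q (Fin.ofNat (T + 1) t) i
    have hfq : ∀ i (t : Fin (T + 1)), f i t = q t i := by
      intro i t
      simp [f]
    have hf : ∀ i, ∀ t < T, ExtArrow (t < M) (f i t) (f i (t + 1)) := by
      intro i t ht
      have := hstep ⟨t, ht⟩ i
      rwa [← hfq, ← hfq] at this
    have hf0 : ∀ i, f i 0 = tailPos r N (s i) := fun i => by
      have := hfq i 0
      rw [hq0] at this
      exact this
    have hfT : ∀ i, f i T = tailPos r N (T - e i) := fun i => by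
      have := hfq i (Fin.last T)
      rw [hqT] at this
      exact this
    have key := fun i => extendPath_restrictWalk (hs i) (he i) (heT i) (hsN i) (hTN i) (hf0 i)
      (hfT i) (hf i)
    have hext : (fun (t : Fin (T + 1)) i => extendPath N (s i) (e i)
        (restrictWalk (s i) (e i) (f i)) t) = q := by
      ext t i : 2
      rw [(key i).2 t (by omega), hfq]
    refine ⟨fun i => restrictWalk (s i) (e i) (f i), ?_, hext⟩
    simp only [Finset.mem_coe, Finset.mem_filter, Finset.mem_univ, true_and]
    refine ⟨hse, fun i => (key i).1, fun i j hij a b hab heq => hij ?_⟩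
    simp only at heq
    refine hqi ⟨s i + a, by have := heT i; have := hse i; omega⟩ ?_
    rw [← hext]
    simp only
    rw [extendPath_add _ (hse i), heq, hab, extendPath_add _ (hse j)]
  · intro p hp
    simp only [Finset.mem_filter, Finset.mem_univ, true_and] at hp
    obtain ⟨-, hpath, hnon⟩ := hp
    rw [if_pos]
    · rw [Finset.prod_comm]
      refine Finset.prod_congr rfl fun i _ => ?_
      rw [← prod_extMatrix_extendPath y (hs i) (he i) (heT i) (hsN i) (hTN i) (hpath i)]
      simp
    · refine ⟨?_, ?_, ?_⟩
      · ext i : 1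
        exact extendPath_of_le (hse i) (hpath i) (Nat.zero_le _)
      · ext i : 1
        exact extendPath_of_ge (hse i) (hpath i) (heT i)
      · intro t i j hij
        by_contra hne
        have htail : ∀ {k l : ℕ}, k ≤ N → l ≤ N → tailPos r N k = tailPos r N l → k = l := by
          intro k l hk hl h
          have := congrArg height h
          rw [height_tailPos hk, height_tailPos hl] at this
          omega
        have hs' := hs i
        have he' := he i
        have hsN' := hsN i
        have hTN' := hTN i
        have hs'' := hs j
        have he'' := he j
        have hsN'' := hsN j
        have hTN'' := hTN j
        have hnes : s i ≠ s j := fun h => hne (hsi h)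
        have hnee : e i ≠ e j := fun h => hne (hei h)
        have hdepth : ∀ {k : ℕ} {v : Vertex r}, 0 < k → k ≤ N →
            tailPos r N k ≠ Sum.inl v := by
          intro k v hk hkN
          obtain ⟨k, rfl⟩ : ∃ k', k = k' + 1 := ⟨k - 1, by omega⟩
          rw [tailPos_succ_of_lt hkN]
          simp
        have ht := t.2
        simp only [extendPath] at hij
        split_ifs at hij with h1 h2 h2
        · exact hnon i j hne _ _ (by simp only; omega) (Sum.inl.inj hij)
        · exact hdepth (by omega) (by omega) hij.symm
        · exact hdepth (by omega) (by omega) hij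
        -- Both paths are on the tail. Before their starts or after their ends, equal positions
        -- force equal starting or ending times; one before and one after would need `t < M < t`.
        · have := htail (by omega) (by omega) hij
          omega

/-- The partition function of non-intersecting paths as a determinant. -/
theorem pathPartition_eq_det (y : ℕ → K) {α n : ℕ} (hn : α ≤ n + 1) :
    pathPartition r y (startTime α) (endTime n α) =
      (Matrix.of fun i j : Fin α =>
        (adjacency r y ^ (endTime n α j - startTime α i)) (Sum.inl 0) (Sum.inl 0)).det := by
  -- The switching time `2 * α - 2` is the latest start, and by `α ≤ n + 1` it does not exceed the
  -- earliest end `2 * n`. The total time `2 * n + 2 * α - 2` is the latest end.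
  have hs : ∀ i, startTime α i ≤ 2 * α - 2 := fun i => by unfold startTime; omega
  have he : ∀ i, 2 * α - 2 ≤ endTime n α i := fun i => by unfold endTime; omega
  have heT : ∀ i, endTime n α i ≤ 2 * n + 2 * α - 2 := fun i => by unfold endTime; omega
  have hsN : ∀ i, startTime α i ≤ 2 * α := fun i => by unfold startTime; omega
  have hTN : ∀ i, 2 * n + 2 * α - 2 - endTime n α i ≤ 2 * α := fun i => by unfold endTime; omega
  -- The initial and the final configurations on the tail are the same tuple.
  have hend : ∀ i, 2 * n + 2 * α - 2 - endTime n α i = startTime α i := fun i => by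
    unfold endTime startTime; omega
  rw [pathPartition_eq_disjointWalkSum (M := 2 * α - 2) (T := 2 * n + 2 * α - 2) (N := 2 * α) y
    hs he heT hsN hTN]
  · let Good : (Fin α → ExtVertex r (2 * α)) → Prop := fun v =>
      StrictAnti (fun i => height (v i)) ∧ ∀ i j, depth (v i) % 2 = depth (v j) % 2
    have hb : Good fun i => tailPos r (2 * α) (startTime α i) := by
      constructor
      · intro i j hij
        simp only [height_tailPos (hsN _)]
        unfold startTime
        have : (i : ℕ) < j := hij
        omega
      · intro i j
        simp only [depth_tailPos (hsN _)]
        unfold startTime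
        omega
    have hinj : ∀ v, Good v → Function.Injective v := fun v hv i j hij =>
      hv.1.injective (congrArg height hij)
    simp only [hend]
    rw [← det_transferProd_eq_disjointWalkSum (extMatrix r (2 * α) y (2 * α - 2))
      (fun i => tailPos r (2 * α) (startTime α i)) Good hinj _ _ (hinj _ hb) _ _ _ hb]
    · congr 1
      ext i j
      simp only [Matrix.of_apply]
      rw [← hend j, transferProd_tail_tail y (hs i) (he j) (heT j) (hsN i) (hTN j)]
    · intro t v w hv hvw hw
      have harr := fun i => extArrow_of_extMatrix_ne_zero (hvw i)
      constructor
      · intro i j hij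
        refine lt_of_le_of_ne ((harr i).height_le (harr j) (hv.2 i j) (hv.1 hij)) fun h => ?_
        exact hij.ne' (hw (height_injective h))
      · intro i j
        have h1 := (harr i).depth_eq
        have h2 := (harr j).depth_eq
        have h3 := hv.2 i j
        omega
    · intro w hw hwb
      choose σ hσ using hwb
      have hσi : Function.Injective σ := fun i j hij => hinj _ hw (by rw [hσ, hσ, hij])
      have hσs : Function.Surjective σ := Finite.surjective_of_injective hσi
      -- Both configurations are strictly ordered by height, so the permutation is increasing and
      -- therefore trivial.
      have hσm : StrictMono σ := by
        intro i j hij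
        have := hw.1 hij
        simp only [hσ] at this
        exact hb.1.lt_iff_gt.1 this
      have : σ = id := by
        refine (StrictMono.range_inj hσm strictMono_id).1 ?_
        rw [hσs.range_eq]
        simp
      ext i : 1
      rw [hσ, this]
      rfl
  · intro i j hij
    unfold startTime at hij
    exact Fin.ext (by omega)
  · intro i j hij
    unfold endTime at hij
    exact Fin.ext (by omega)

end Families

/-! ### Weighted walks and their behaviour under a change of weights -/

section Walks

variable {K : Type*} [Field K] {r : ℕ}

/-- The weight of all walks of `n` steps from the vertex `k` to the vertex `0`. -/
noncomputable def chainWalk (r : ℕ) (y : ℕ → K) (n k : ℕ) : K :=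
  if h : k < r + 3 then (adjacency r y ^ n) (Sum.inl ⟨k, h⟩) (Sum.inl 0) else 0

theorem sum_adjacency_inr (y : ℕ → K) (k : Fin (r - 1)) (f : Vertex r → K) :
    ∑ w, adjacency r y (Sum.inr k) w * f w =
      y (2 * ((k : ℕ) + 2) - 1) * f (Sum.inl ⟨k + 2, by omega⟩) := by
  rw [Finset.sum_eq_single (Sum.inl ⟨k + 2, by omega⟩) _ (by simp)]
  · simp [adjacency, Arrow, edgeWeight]
  · rintro (w | w) _ hw
    · have : ¬(w : ℕ) = k + 2 := fun h => hw (congrArg _ (Fin.ext h))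
      simp [adjacency, Arrow, this]
    · simp [adjacency, Arrow]

theorem sum_adjacency_inl (y : ℕ → K) (k : ℕ) (hk : k < r + 3) (f : Vertex r → K) :
    ∑ w, adjacency r y (Sum.inl ⟨k, hk⟩) w * f w =
      (if h : k + 1 < r + 3 then f (Sum.inl ⟨k + 1, h⟩) else 0) +
      (if h : 1 ≤ k then y (chainLabel r (k - 1)) * f (Sum.inl ⟨k - 1, by omega⟩) else 0) +
      (if h : 2 ≤ k ∧ k ≤ r then f (Sum.inr ⟨k - 2, by omega⟩) else 0) := by
  rw [Fintype.sum_sum_type]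
  congr 1
  · have : ∀ w : Fin (r + 3), adjacency r y (Sum.inl ⟨k, hk⟩) (Sum.inl w) * f (Sum.inl w) =
        (if (w : ℕ) = k + 1 then f (Sum.inl w) else 0) +
        (if k = (w : ℕ) + 1 then y (chainLabel r w) * f (Sum.inl w) else 0) := by
      intro w
      rcases lt_trichotomy (w : ℕ) k with h | h | h
      · simp only [adjacency, Matrix.of_apply, Arrow, edgeWeight, if_neg h.not_gt,
          false_or, show ((w : ℕ) = k + 1) = False from eq_false (by omega), ite_mul, zero_mul,
          if_false, zero_add]
      · simp [adjacency, Arrow, h]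
      · simp only [adjacency, Matrix.of_apply, Arrow, edgeWeight, if_pos h,
          or_false, show (k = (w : ℕ) + 1) = False from eq_false (by omega), ite_mul, zero_mul,
          one_mul, if_false, add_zero]
    simp only [this, Finset.sum_add_distrib]
    congr 1
    · split_ifs with h
      · rw [Finset.sum_eq_single ⟨k + 1, h⟩ _ (by simp)]
        · simp
        · intro w _ hw
          exact if_neg fun h' => hw (Fin.ext h')
      · exact Finset.sum_eq_zero fun w _ => if_neg (by omega)
    · split_ifs with h
      · rw [Finset.sum_eq_single ⟨k - 1, by omega⟩ _ (by simp)]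
        · rw [if_pos (by simp only; omega)]
        · intro w _ hw
          refine if_neg fun h' => hw (Fin.ext ?_)
          simp only
          omega
      · exact Finset.sum_eq_zero fun w _ => if_neg (by omega)
  · split_ifs with h
    · rw [Finset.sum_eq_single ⟨k - 2, by omega⟩ _ (by simp)]
      · have : k = k - 2 + 2 := by omega
        simp [adjacency, Arrow, edgeWeight, ← this]
      · intro w _ hw
        have : ¬k = (w : ℕ) + 2 := fun h' => hw (Fin.ext (by simp only; omega))
        simp [adjacency, Arrow, this]
    · refine Finset.sum_eq_zero fun w _ => ?_
      have : ¬k = (w : ℕ) + 2 := by omega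
      simp [adjacency, Arrow, this]

theorem adjacency_pow_succ (y : ℕ → K) (n : ℕ) (v : Vertex r) :
    (adjacency r y ^ (n + 1)) v (Sum.inl 0) =
      ∑ w, adjacency r y v w * (adjacency r y ^ n) w (Sum.inl 0) := by
  rw [pow_succ', Matrix.mul_apply]

theorem chainWalk_succ_zero (y : ℕ → K) (n : ℕ) :
    chainWalk r y (n + 1) 0 = chainWalk r y n 1 := by
  rw [chainWalk, dif_pos (by omega), adjacency_pow_succ, sum_adjacency_inl, chainWalk]
  simp

theorem chainWalk_succ_one (y : ℕ → K) (n : ℕ) :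
    chainWalk r y (n + 1) 1 = chainWalk r y n 2 + y 1 * chainWalk r y n 0 := by
  rw [chainWalk, dif_pos (by omega), adjacency_pow_succ, sum_adjacency_inl, chainWalk, chainWalk]
  simp [chainLabel]

/-- The excursion from `k + 1` to `(k + 1)'` and back takes two steps and has weight `y (2 * k +
1)`. For `k = r` this role falls to the end vertex `r + 2`, whose only neighbour is `r + 1`; the
term for `k + 2` is then absorbed, which is why it is switched off. -/
theorem chainWalk_succ_succ (y : ℕ → K) (n : ℕ) {k : ℕ} (hk : 1 ≤ k) (hkr : k ≤ r) :
    chainWalk r y (n + 2) (k + 1) = (if k + 1 ≤ r then chainWalk r y (n + 1) (k + 2) else 0) +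
      y (2 * k + 1) * chainWalk r y n (k + 1) + y (2 * k) * chainWalk r y (n + 1) k := by
  conv_lhs => rw [chainWalk, dif_pos (by omega), adjacency_pow_succ, sum_adjacency_inl,
    dif_pos (show k + 1 + 1 < r + 3 by omega), dif_pos (show 1 ≤ k + 1 by omega)]
  simp only [add_tsub_cancel_right, chainLabel, if_neg (show ¬k = 0 by omega), if_pos hkr]
  rw [chainWalk, dif_pos (show k + 2 < r + 3 by omega), chainWalk,
    dif_pos (show k + 1 < r + 3 by omega), chainWalk, dif_pos (show k < r + 3 by omega)]
  by_cases hkr' : k + 1 ≤ r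
  · rw [dif_pos (show 2 ≤ k + 1 ∧ k + 1 ≤ r by omega), if_pos hkr',
      adjacency_pow_succ y n (Sum.inr _), sum_adjacency_inr]
    simp only [show k + 1 - 2 + 2 = k + 1 by omega, show 2 * (k + 1) - 1 = 2 * k + 1 by omega]
    ring
  · obtain rfl : k = r := by omega
    rw [dif_neg (show ¬(2 ≤ k + 1 ∧ k + 1 ≤ k) by omega), if_neg hkr',
      adjacency_pow_succ y n (Sum.inl ⟨k + 2, _⟩),
      sum_adjacency_inl, dif_neg (show ¬k + 2 + 1 < k + 3 by omega),
      dif_pos (show 1 ≤ k + 2 by omega), dif_neg (show ¬(2 ≤ k + 2 ∧ k + 2 ≤ k) by omega)]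
    simp only [show k + 2 - 1 = k + 1 by omega, chainLabel, if_neg (show ¬k + 1 = 0 by omega),
      if_neg (show ¬k + 1 ≤ k by omega)]
    ring

/-- One step changes the depth by one, so `0` is out of reach. The extended graph with empty tail
serves only to apply `ExtArrow.depth_eq`. -/
theorem adjacency_pow_eq_zero (y : ℕ → K) (n : ℕ) : ∀ v : Vertex r,
    (n : ℤ) < depth (Sum.inl v : ExtVertex r 0) → (adjacency r y ^ n) v (Sum.inl 0) = 0 := by
  induction n with
  | zero =>
    intro v hv
    rw [pow_zero, Matrix.one_apply, if_neg]
    rintro rfl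
    simp [depth] at hv
  | succ n ih =>
    intro v hv
    rw [adjacency_pow_succ]
    refine Finset.sum_eq_zero fun w _ => ?_
    by_cases h : Arrow r v w
    · have := ExtArrow.depth_eq (up := True) (a := (Sum.inl v : ExtVertex r 0)) (b := Sum.inl w) h
      rw [ih w (by push_cast at hv; omega), mul_zero]
    · simp [adjacency, h]

theorem chainWalk_eq_zero (y : ℕ → K) {n k : ℕ} (h : n < k) : chainWalk r y n k = 0 := by
  rw [chainWalk]
  split_ifs with hk
  · exact adjacency_pow_eq_zero y n _ (by simpa [depth] using h)
  · rfl

/-- The recursion satisfied by the weights `a m k` of the walks of `k + 2 m` steps from the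
vertex `k` to `0`, where `q k` and `e k` are the weights `y (2 k - 1)` and `y (2 k)`. -/
structure WalkRec (a : ℕ → ℕ → K) (q e : ℕ → K) : Prop where
  zero_one : a 0 1 = q 1
  zero_succ : ∀ k, 1 ≤ k → a 0 (k + 1) = e k * a 0 k
  succ_one : ∀ m, a (m + 1) 1 = a m 2 + q 1 * a m 1
  succ_succ : ∀ m k, 1 ≤ k → a (m + 1) (k + 1) = a m (k + 2) + q (k + 1) * a m (k + 1) +
    e k * a (m + 1) k

/-- The effect of a translation of the initial data on the weights of walks. -/
theorem WalkRec.shift {a a' : ℕ → ℕ → K} {q e q' e' : ℕ → K} (h : WalkRec a q e)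
    (h' : WalkRec a' q' e') {l : ℕ} (ha : ∀ m k, l < k → a m k = 0)
    (ha' : ∀ m k, l < k → a' m k = 0)
    (h1 : q 1 = q' 1 + e' 1) (h2 : ∀ k, 1 ≤ k → k < l → q (k + 1) + e k = q' (k + 1) + e' (k + 1))
    (h3 : ∀ k, 1 ≤ k → k < l → (q' (k + 1) + e' (k + 1)) * e' k = (q' k + e' k) * e k) :
    ∀ m k, 1 ≤ k → a' m (k + 1) + q' k * a' m k = q' 1 * a m k := by
  intro m
  -- The recursion expresses the value at `(m + 1, k + 1)` through level `m` and through `(m + 1,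
  -- k)`, hence the induction on `m` with an inner one on `k`. Past the cutoff `l` all three terms
  -- vanish.
  induction m with
  | zero =>
    intro k hk
    induction k, hk using Nat.le_induction with
    | base =>
      rw [h'.zero_succ 1 le_rfl, h'.zero_one, h.zero_one, h1]
      ring
    | succ k hk ih =>
      rcases Nat.lt_or_ge k l with hkl | hkl
      · rw [h'.zero_succ k hk] at ih
        rw [h'.zero_succ (k + 1) (by omega), h'.zero_succ k hk, h.zero_succ k hk]
        linear_combination e k * ih + a' 0 k * h3 k hk hkl
      · rw [ha _ _ (by omega), ha' _ _ (by omega), ha' _ _ (by omega)]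
        ring
  | succ m ihm =>
    intro k hk
    induction k, hk using Nat.le_induction with
    | base =>
      rw [h'.succ_succ m 1 le_rfl, h'.succ_one, h.succ_one]
      linear_combination ihm 2 (by omega) + q 1 * ihm 1 le_rfl -
        (a' m 2 + q' 1 * a' m 1) * h1
    | succ k hk ih =>
      rcases Nat.lt_or_ge k l with hkl | hkl
      · have e1 := h'.succ_succ m k hk
        have e2 := h'.succ_succ m (k + 1) (by omega)
        have e3 := h.succ_succ m k hk
        have i1 := ihm (k + 1) (by omega)
        have i2 := ihm (k + 2) (by omega)
        rw [e1] at ih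
        rw [e2, e1, e3]
        linear_combination i2 + q (k + 1) * i1 + e k * ih + a' (m + 1) k * h3 k hk hkl -
          (a' m (k + 2) + q' (k + 1) * a' m (k + 1)) * h2 k hk hkl
      · rw [ha _ _ (by omega), ha' _ _ (by omega), ha' _ _ (by omega)]
        ring

/-- The even weights, with the convention `y (2 r + 2) = 0`. -/
def evenWeight (r : ℕ) (y : ℕ → K) (k : ℕ) : K := if k ≤ r then y (2 * k) else 0

/-- The cutoff at `r + 1` is consistent because the vertex `r + 2` has become the loop weight `q (r
+ 1)` and `evenWeight` vanishes at `r + 1`. -/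
theorem walkRec_chainWalk (hr : 1 ≤ r) (y : ℕ → K) :
    WalkRec (fun m k => if k ≤ r + 1 then chainWalk r y (k + 2 * m) k else 0)
      (fun k => y (2 * k - 1)) (evenWeight r y) where
  zero_one := by
    have h0 : chainWalk r y 0 0 = 1 := by simp [chainWalk]
    have h2 : chainWalk r y 0 2 = 0 := chainWalk_eq_zero y (by omega)
    simp [chainWalk_succ_one y 0, h0, h2]
  zero_succ := by
    intro k hk
    by_cases hkr : k ≤ r
    · obtain ⟨k, rfl⟩ : ∃ k', k = k' + 1 := ⟨k - 1, by omega⟩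
      simp only [mul_zero, add_zero, evenWeight, if_pos hkr, if_pos (show k + 1 ≤ r + 1 by omega),
        if_pos (show k + 1 + 1 ≤ r + 1 by omega)]
      rw [chainWalk_succ_succ y k (by omega) hkr,
        chainWalk_eq_zero y (show k + 1 < k + 1 + 2 by omega),
        chainWalk_eq_zero y (show k < k + 1 + 1 by omega)]
      simp
    · simp [evenWeight, hkr]
  succ_one := by
    intro m
    simp only [if_pos (show 1 ≤ r + 1 by omega), if_pos (show 2 ≤ r + 1 by omega)]
    rw [show 1 + 2 * (m + 1) = 2 + 2 * m + 1 by ring, chainWalk_succ_one,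
      show 2 + 2 * m = 1 + 2 * m + 1 by ring, chainWalk_succ_zero]
  succ_succ := by
    intro m k hk
    by_cases hkr : k ≤ r
    · simp only [evenWeight, if_pos hkr, if_pos (show k ≤ r + 1 by omega),
        if_pos (show k + 1 ≤ r + 1 by omega)]
      rw [show k + 1 + 2 * (m + 1) = k + 1 + 2 * m + 2 by ring, chainWalk_succ_succ y _ hk hkr,
        show 2 * (k + 1) - 1 = 2 * k + 1 by omega]
      simp only [show k + 2 + 2 * m = k + 1 + 2 * m + 1 by ring,
        show k + 2 * (m + 1) = k + 1 + 2 * m + 1 by ring,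
        show (k + 2 ≤ r + 1) = (k + 1 ≤ r) from propext (by omega)]
    · simp [evenWeight, hkr, show ¬k + 2 ≤ r + 1 by omega]

end Walks

/-! ### The first row, and the path formula for all rows -/

section FirstRow

variable {K : Type*} [Field K] {r : ℕ} {R : ℕ → ℤ → K}

theorem IsSolution.translate (hR : IsSolution r R) (t : ℤ) :
    IsSolution r fun α n => R α (n + t) where
  rel α h1 h2 n := by
    have := hR.rel α h1 h2 (n + t)
    rwa [show n + t + 1 = n + 1 + t by ring, show n + t - 1 = n - 1 + t by ring] at this
  left n := hR.left _
  right n := hR.right _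

theorem NonVanishing.translate (hnv : NonVanishing r R) (t : ℤ) :
    NonVanishing r fun α n => R α (n + t) := fun α h1 h2 n => hnv α h1 h2 (n + t)

theorem IsSolution.ne_zero (hR : IsSolution r R) (hnv : NonVanishing r R) {α : ℕ}
    (hα : α ≤ r + 1) (n : ℤ) : R α n ≠ 0 := by
  rcases Nat.eq_zero_or_pos α with rfl | hpos
  · simp [hR.left]
  · rcases hα.eq_or_lt with rfl | hlt
    · simp [hR.right]
    · exact hnv α hpos (by omega) n

theorem weight_odd (R : ℕ → ℤ → K) (k : ℕ) :
    weight R (2 * k + 1) = R k 0 * R (k + 1) 1 / (R (k + 1) 0 * R k 1) := by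
  rw [weight, if_pos (by omega), show (2 * k + 1 - 1) / 2 = k by omega,
    show (2 * k + 1 + 1) / 2 = k + 1 by omega]

theorem weight_even (R : ℕ → ℤ → K) (k : ℕ) :
    weight R (2 * (k + 1)) = R k 0 * R (k + 2) 1 / (R (k + 1) 0 * R (k + 1) 1) := by
  rw [weight, if_neg (by omega), show 2 * (k + 1) / 2 = k + 1 by omega]
  rfl

/-- Both sums of neighbouring weights that the translation exchanges. -/
theorem IsSolution.weight_add (hR : IsSolution r R) (hnv : NonVanishing r R) {k : ℕ} (hk : k ≤ r) :
    weight R (2 * k + 1) + evenWeight r (weight R) (k + 1) =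
      R k 0 * R (k + 1) 2 / (R (k + 1) 1 * R k 1) := by
  have n1 := hR.ne_zero hnv (show k ≤ r + 1 by omega) 1
  have n2 := hR.ne_zero hnv (show k + 1 ≤ r + 1 by omega) 0
  have n3 := hR.ne_zero hnv (show k + 1 ≤ r + 1 by omega) 1
  rw [weight_odd, evenWeight]
  split_ifs with h
  · have hrel := hR.rel (k + 1) (by omega) h 1
    simp only [add_tsub_cancel_right, sub_self, one_add_one_eq_two] at hrel
    rw [weight_even]
    field_simp
    linear_combination -R k 0 * hrel
  · obtain rfl : k = r := by omega
    simp [hR.right]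

/-- The relation at `n = 1` is used as in `IsSolution.weight_add`, now for the translated weights.
The right side is that of `IsSolution.weight_add` at `k + 1`, so the two sums agree; this is the
second hypothesis of `WalkRec.shift`. -/
theorem IsSolution.weight_add' (hR : IsSolution r R) (hnv : NonVanishing r R) {k : ℕ}
    (hk : k + 1 ≤ r) :
    weight (fun α n => R α (n + 1)) (2 * (k + 1) + 1) +
        weight (fun α n => R α (n + 1)) (2 * (k + 1)) =
      R (k + 1) 0 * R (k + 2) 2 / (R (k + 2) 1 * R (k + 1) 1) := by
  have n0 := hR.ne_zero hnv (show k + 1 ≤ r + 1 by omega) 0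
  have n1 := hR.ne_zero hnv (show k + 1 ≤ r + 1 by omega) 1
  have n2 := hR.ne_zero hnv (show k + 1 ≤ r + 1 by omega) 2
  have n3 := hR.ne_zero hnv (show k + 2 ≤ r + 1 by omega) 1
  have hrel := hR.rel (k + 1) (by omega) hk 1
  simp only [add_tsub_cancel_right, sub_self, one_add_one_eq_two] at hrel
  rw [weight_odd, weight_even]
  simp only [zero_add, one_add_one_eq_two, add_assoc]
  field_simp
  linear_combination -R (k + 2) 2 * hrel

/-- The induction step for the first row: the weights before and after the translation satisfy the
hypotheses of `WalkRec.shift`, whose conclusion at `k = 1` combines with `WalkRec.succ_one` into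
this identity. -/
theorem IsSolution.chainWalk_shift (hR : IsSolution r R) (hnv : NonVanishing r R) (hr : 1 ≤ r)
    (m : ℕ) :
    chainWalk r (weight R) (2 * (m + 1)) 0 =
      weight R 1 * chainWalk r (weight fun α n => R α (n + 1)) (2 * m) 0 := by
  have hw' := walkRec_chainWalk hr (weight R)
  have hw := walkRec_chainWalk hr (weight fun α n => R α (n + 1))
  cases m with
  | zero =>
    have h0 : chainWalk r (weight fun α n => R α (n + 1)) 0 0 = 1 := by simp [chainWalk]
    have := hw'.zero_one
    simp only [if_pos (show 1 ≤ r + 1 by omega)] at this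
    rw [mul_zero, h0, mul_one, show 2 * (0 + 1) = 1 + 2 * 0 + 1 by ring, chainWalk_succ_zero, this]
  | succ m =>
    have key := hw.shift hw' (l := r + 1) (fun m k hk => if_neg (by omega))
      (fun m k hk => if_neg (by omega)) ?_ ?_ ?_ m 1 le_rfl
    · rw [← hw'.succ_one] at key
      simp only [if_pos (show 1 ≤ r + 1 by omega)] at key
      rw [show 2 * (m + 1 + 1) = 1 + 2 * (m + 1) + 1 by ring, chainWalk_succ_zero, key,
        show 2 * (m + 1) = 1 + 2 * m + 1 by ring, chainWalk_succ_zero]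
    · have := hR.weight_add hnv (Nat.zero_le r)
      simp only [mul_zero, zero_add] at this
      simp only [mul_one, show 2 - 1 = 1 from rfl]
      rw [this, show 1 = 2 * 0 + 1 from rfl, weight_odd]
      simp [hR.left, one_add_one_eq_two]
    · intro k hk hkl
      obtain ⟨k, rfl⟩ : ∃ k', k = k' + 1 := ⟨k - 1, by omega⟩
      have e1 := hR.weight_add hnv (show k + 1 ≤ r by omega)
      have e2 := hR.weight_add' hnv (show k + 1 ≤ r by omega)
      simp only [show 2 * (k + 1 + 1) - 1 = 2 * (k + 1) + 1 by omega]
      rw [e1, ← e2, evenWeight, if_pos (by omega)]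
    · intro k hk hkl
      obtain ⟨k, rfl⟩ : ∃ k', k = k' + 1 := ⟨k - 1, by omega⟩
      have e1 := hR.weight_add hnv (show k + 1 ≤ r by omega)
      have e0 := hR.weight_add hnv (show k ≤ r by omega)
      simp only [show 2 * (k + 1 + 1) - 1 = 2 * (k + 1) + 1 by omega,
        show 2 * (k + 1) - 1 = 2 * k + 1 by omega]
      rw [e1, e0, evenWeight, if_pos (by omega), evenWeight, if_pos (by omega), weight_even,
        weight_even]
      have n0 := hR.ne_zero hnv (show k ≤ r + 1 by omega) 1
      have n1 := hR.ne_zero hnv (show k + 1 ≤ r + 1 by omega) 0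
      have n2 := hR.ne_zero hnv (show k + 1 ≤ r + 1 by omega) 1
      have n3 := hR.ne_zero hnv (show k + 1 ≤ r + 1 by omega) 2
      have n4 := hR.ne_zero hnv (show k + 2 ≤ r + 1 by omega) 1
      simp only [zero_add, one_add_one_eq_two, add_assoc]
      field_simp

/-- The first row of a non-vanishing solution counts weighted walks. -/
theorem IsSolution.first_row (hr : 1 ≤ r) (n : ℕ) : ∀ {R : ℕ → ℤ → K}, IsSolution r R →
    NonVanishing r R →
    R 1 n = R 1 0 * (adjacency r (weight R) ^ (2 * n)) (Sum.inl 0) (Sum.inl 0) := by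
  induction n with
  | zero => intro R _ _; simp
  | succ n ih =>
    intro R hR hnv
    have h := hR.chainWalk_shift hnv hr n
    -- The entry at time `n + 1` is the entry at time `n` of the translated solution, whose weights
    -- differ; hence the induction over all solutions.
    have h2 := ih (hR.translate 1) (hnv.translate 1)
    simp only [chainWalk, show 0 < r + 3 by omega, dite_true, Fin.mk_zero'] at h
    have n1 := hnv 1 le_rfl hr 0
    have hw : weight R 1 = R 1 1 / R 1 0 := by simpa [hR.left] using weight_odd R 0
    rw [h, Nat.cast_succ, h2, hw, zero_add]
    field_simp

/-- Non-vanishing solutions count families of non-intersecting paths. -/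
theorem IsSolution.eq_pathPartition (hR : IsSolution r R) (hnv : NonVanishing r R) (hr : 1 ≤ r)
    {α n : ℕ} (hα : α ≤ r) (hn : α ≤ n + 1) :
    R α n = R 1 0 ^ α * pathPartition r (weight R) (startTime α) (endTime n α) := by
  rw [pathPartition_eq_det _ hn, (hR.eq_hankelDet hnv α).1 (by omega), hankelDet]
  -- Reversing rows and columns turns the index `n - α + 1 + i + j` into `n + α - 1 - i - j`, half
  -- the length of a path from the `i`-th start to the `j`-th end. The factor `R 1 0` of each entry
  -- gives `R 1 0 ^ α`.
  rw [← Matrix.det_submatrix_equiv_self Fin.revPerm]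
  conv_lhs => rw [← mul_one (Matrix.det _)]
  have h := Matrix.det_smul (Matrix.of fun i j : Fin α =>
    (adjacency r (weight R) ^ (endTime n α j - startTime α i)) (Sum.inl 0) (Sum.inl 0)) (R 1 0)
  rw [Fintype.card_fin] at h
  rw [← h, mul_one]
  congr 1
  ext i j
  simp only [Matrix.submatrix_apply, Matrix.of_apply, Matrix.smul_apply, smul_eq_mul,
    Fin.revPerm_apply]
  rw [show endTime n α j - startTime α i = 2 * (n + α - 1 - i - j) by
    unfold startTime endTime; omega, ← IsSolution.first_row hr _ hR hnv]
  congr 1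
  have := Fin.val_rev i
  have := Fin.val_rev j
  omega

end FirstRow

/-! ### Laurent monomials and substitution of variables -/

section Laurent

variable {K : Type*} [Field K] {ι κ : Type*} [Fintype ι] [Fintype κ]

theorem laurentMonomial_zero (x : ι → K) : laurentMonomial 0 x = 1 := by
  simp [laurentMonomial]

theorem laurentMonomial_add {x : ι → K} (hx : ∀ v, x v ≠ 0) (m m' : ι → ℤ) :
    laurentMonomial (m + m') x = laurentMonomial m x * laurentMonomial m' x := by
  simp [laurentMonomial, zpow_add₀ (hx _), Finset.prod_mul_distrib]

theorem laurentMonomial_sub {x : ι → K} (hx : ∀ v, x v ≠ 0) (m m' : ι → ℤ) :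
    laurentMonomial (m - m') x = laurentMonomial m x / laurentMonomial m' x := by
  simp [laurentMonomial, zpow_sub₀ (hx _), Finset.prod_div_distrib]

theorem laurentMonomial_sum {x : ι → K} (hx : ∀ v, x v ≠ 0) {J : Type*} (s : Finset J)
    (m : J → ι → ℤ) : laurentMonomial (∑ j ∈ s, m j) x = ∏ j ∈ s, laurentMonomial (m j) x := by
  classical
  induction s using Finset.induction_on with
  | empty => simp [laurentMonomial_zero]
  | insert j s hj ih => rw [Finset.sum_insert hj, Finset.prod_insert hj, laurentMonomial_add hx, ih]

theorem laurentMonomial_nsmul {x : ι → K} (hx : ∀ v, x v ≠ 0) (n : ℕ) (m : ι → ℤ) :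
    laurentMonomial (n • m) x = laurentMonomial m x ^ n := by
  induction n with
  | zero => simp [laurentMonomial_zero]
  | succ n ih => rw [succ_nsmul, laurentMonomial_add hx, ih, pow_succ]

theorem PosLaurent.eval_sum_single {J : Type*} (s : Finset J) (m : J → ι → ℤ) (x : ι → K) :
    PosLaurent.eval (∑ j ∈ s, Finsupp.single (m j) 1) x = ∑ j ∈ s, laurentMonomial (m j) x := by
  classical
  unfold PosLaurent.eval
  rw [← Finsupp.sum_finsetSum_index (by simp) (by intros; push_cast; ring)]
  refine Finset.sum_congr rfl fun j _ => ?_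
  rw [Finsupp.sum_single_index (by simp)]
  simp

/-- The exponent vector of a monomial after a substitution of variables. -/
def pushExponent (g : ι → κ) [DecidableEq κ] (m : ι → ℤ) (v : κ) : ℤ :=
  ∑ u, if g u = v then m u else 0

theorem laurentMonomial_pushExponent [DecidableEq κ] {x : κ → K} (hx : ∀ v, x v ≠ 0) (g : ι → κ)
    (m : ι → ℤ) : laurentMonomial (pushExponent g m) x = laurentMonomial m (x ∘ g) := by
  have hsum : pushExponent g m = ∑ u, fun v => if g u = v then m u else 0 := by
    ext v
    simp [pushExponent]
  rw [hsum, laurentMonomial_sum hx]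
  refine Finset.prod_congr rfl fun u _ => ?_
  rw [laurentMonomial, Finset.prod_eq_single (g u) _ (by simp)]
  · simp
  · intro v _ hv
    simp [Ne.symm hv]

/-- Coefficients of exponent vectors that become equal are added, so non-negativity survives. It
serves for the shift of the rank and for time reversal. -/
theorem PosLaurent.eval_mapDomain [DecidableEq κ] {x : κ → K} (hx : ∀ v, x v ≠ 0) (g : ι → κ)
    (P : PosLaurent ι) :
    PosLaurent.eval (Finsupp.mapDomain (pushExponent g) P) x = P.eval (x ∘ g) := by
  unfold PosLaurent.eval
  rw [Finsupp.sum_mapDomain_index (by simp) (by intros; push_cast; ring)]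
  simp only [laurentMonomial_pushExponent hx]

end Laurent

/-! ### Laurent positivity for `n ≥ α - 1` -/

section Exponents

variable {K : Type*} [Field K] {r : ℕ} {R : ℕ → ℤ → K}

theorem NonVanishing.initialData_ne_zero (hnv : NonVanishing r R) (v : InitVar r) :
    initialData r R v ≠ 0 := hnv _ (by omega) (by omega) _

/-- The exponent vector of the initial variable `R α k`, `k = 0, 1`; it is zero for `α = 0` and
for `α = r + 1`. -/
def initExponent (r α k : ℕ) (v : InitVar r) : ℤ :=
  if (v.1 : ℕ) + 1 = α ∧ (v.2 : ℕ) = k then 1 else 0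

theorem IsSolution.laurentMonomial_initExponent (hR : IsSolution r R) {α k : ℕ} (hα : α ≤ r + 1)
    (hk : k < 2) : laurentMonomial (initExponent r α k) (initialData r R) = R α k := by
  by_cases h : 1 ≤ α ∧ α ≤ r
  · rw [laurentMonomial, Finset.prod_eq_single (⟨α - 1, by omega⟩, ⟨k, hk⟩) _ (by simp)]
    · simp [initExponent, initialData, show α - 1 + 1 = α by omega]
    · rintro ⟨a, b⟩ _ hv
      rw [initExponent, if_neg, zpow_zero]
      rintro ⟨h1, h2⟩
      exact hv (Prod.ext (Fin.ext (by simp only at h1 ⊢; omega)) (Fin.ext h2))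
  · have h0 : initExponent r α k = 0 := by
      ext v
      rw [initExponent, if_neg (by omega)]
      rfl
    rw [h0, laurentMonomial_zero]
    rcases Nat.eq_zero_or_pos α with rfl | hpos
    · exact (hR.left _).symm
    · obtain rfl : α = r + 1 := by omega
      exact (hR.right _).symm

/-- The exponent vectors of the weights. -/
def weightExponent (r j : ℕ) : InitVar r → ℤ :=
  if j % 2 = 1 then
    initExponent r ((j - 1) / 2) 0 + initExponent r ((j + 1) / 2) 1 -
      (initExponent r ((j + 1) / 2) 0 + initExponent r ((j - 1) / 2) 1)
  else
    initExponent r (j / 2 - 1) 0 + initExponent r (j / 2 + 1) 1 -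
      (initExponent r (j / 2) 0 + initExponent r (j / 2) 1)

theorem IsSolution.weight_eq (hR : IsSolution r R) (hnv : NonVanishing r R) {j : ℕ}
    (hj : j ≤ 2 * r + 1) :
    weight R j = laurentMonomial (weightExponent r j) (initialData r R) := by
  have hx := hnv.initialData_ne_zero
  have h0 : ∀ α ≤ r + 1, laurentMonomial (initExponent r α 0) (initialData r R) = R α 0 :=
    fun α hα => hR.laurentMonomial_initExponent hα (by omega)
  have h1 : ∀ α ≤ r + 1, laurentMonomial (initExponent r α 1) (initialData r R) = R α 1 :=
    fun α hα => hR.laurentMonomial_initExponent hα (by omega)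
  unfold weight weightExponent
  split_ifs with h
  · rw [laurentMonomial_sub hx, laurentMonomial_add hx, laurentMonomial_add hx, h0 _ (by omega),
      h1 _ (by omega), h0 _ (by omega), h1 _ (by omega)]
  · rw [laurentMonomial_sub hx, laurentMonomial_add hx, laurentMonomial_add hx, h0 _ (by omega),
      h1 _ (by omega), h0 _ (by omega), h1 _ (by omega)]

/-- The exponent vectors of the weights of the arrows. -/
def edgeExponent (r : ℕ) : Vertex r → Vertex r → InitVar r → ℤ
  | Sum.inl a, Sum.inl b => if (a : ℕ) < b then 0 else weightExponent r (chainLabel r b)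
  | Sum.inr a, Sum.inl _ => weightExponent r (2 * ((a : ℕ) + 2) - 1)
  | _, _ => 0

theorem chainLabel_le {r k : ℕ} : chainLabel r k ≤ 2 * r + 1 := by
  unfold chainLabel
  split_ifs <;> omega

theorem IsSolution.edgeWeight_eq (hR : IsSolution r R) (hnv : NonVanishing r R) (a b : Vertex r) :
    edgeWeight r (weight R) a b = laurentMonomial (edgeExponent r a b) (initialData r R) := by
  rcases a with a | a <;> rcases b with b | b
  · simp only [edgeWeight, edgeExponent]
    split_ifs
    · rw [laurentMonomial_zero]
    · exact hR.weight_eq hnv chainLabel_le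
  · simp [edgeWeight, edgeExponent, laurentMonomial_zero]
  · exact hR.weight_eq hnv (by omega)
  · simp [edgeWeight, edgeExponent, laurentMonomial_zero]

open Classical in
/-- The Laurent polynomial `R_{1,0}^α Z_{α,n}`. -/
noncomputable def pathLaurent (r α n : ℕ) : PosLaurent (InitVar r) :=
  ∑ p : (∀ i : Fin α, Fin (endTime n α i - startTime α i + 1) → Vertex r) with
      IsNonIntersectingFamily r (startTime α) (endTime n α) p,
    Finsupp.single (α • initExponent r 1 0 +
      ∑ i, ∑ t : Fin (endTime n α i - startTime α i),
        edgeExponent r (p i t.castSucc) (p i t.succ)) 1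

theorem IsSolution.eq_pathLaurent (hR : IsSolution r R) (hnv : NonVanishing r R) (hr : 1 ≤ r)
    {α n : ℕ} (hα : α ≤ r) (hn : α ≤ n + 1) :
    R α n = (pathLaurent r α n).eval (initialData r R) := by
  classical
  have hx := hnv.initialData_ne_zero
  rw [hR.eq_pathPartition hnv hr hα hn, pathLaurent, PosLaurent.eval_sum_single, pathPartition,
    Finset.mul_sum]
  refine Finset.sum_congr rfl fun p _ => ?_
  rw [laurentMonomial_add hx, laurentMonomial_nsmul hx,
    hR.laurentMonomial_initExponent (by omega) (by omega), laurentMonomial_sum hx]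
  refine congrArg₂ _ rfl (Finset.prod_congr rfl fun i _ => ?_)
  rw [laurentMonomial_sum hx, pathWeight]
  exact Finset.prod_congr rfl fun t _ => hR.edgeWeight_eq hnv _ _

end Exponents

/-! ### Specialization of fractions -/

section Specialization

variable {A F K : Type*} [CommRing A] [Field F] [Field K] {ψ : A →+* F} {φ : A →+* K}

/-- `a` and `b` are the images of one fraction over `A`, whose denominator survives in `K`. -/
def Specializes (ψ : A →+* F) (φ : A →+* K) (a : F) (b : K) : Prop :=
  ∃ p q : A, φ q ≠ 0 ∧ a * ψ q = ψ p ∧ b * φ q = φ p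

theorem specializes_map (p : A) : Specializes ψ φ (ψ p) (φ p) := ⟨p, 1, by simp, by simp, by simp⟩

theorem specializes_zero : Specializes ψ φ 0 0 := by
  simpa using specializes_map (ψ := ψ) (φ := φ) 0

theorem specializes_one : Specializes ψ φ 1 1 := by
  simpa using specializes_map (ψ := ψ) (φ := φ) 1

theorem specializes_natCast (n : ℕ) : Specializes ψ φ n n := by
  simpa using specializes_map (ψ := ψ) (φ := φ) n

theorem Specializes.add {a c : F} {b d : K} (h : Specializes ψ φ a b) (h' : Specializes ψ φ c d) :
    Specializes ψ φ (a + c) (b + d) := by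
  obtain ⟨p, q, hq, h1, h2⟩ := h
  obtain ⟨p', q', hq', h1', h2'⟩ := h'
  refine ⟨p * q' + p' * q, q * q', by simp [hq, hq'], ?_, ?_⟩
  · simp only [map_mul, map_add, ← h1, ← h1']; ring
  · simp only [map_mul, map_add, ← h2, ← h2']; ring

theorem Specializes.mul {a c : F} {b d : K} (h : Specializes ψ φ a b) (h' : Specializes ψ φ c d) :
    Specializes ψ φ (a * c) (b * d) := by
  obtain ⟨p, q, hq, h1, h2⟩ := h
  obtain ⟨p', q', hq', h1', h2'⟩ := h'
  refine ⟨p * p', q * q', by simp [hq, hq'], ?_, ?_⟩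
  · simp only [map_mul, ← h1, ← h1']; ring
  · simp only [map_mul, ← h2, ← h2']; ring

/-- If `a = 0`, injectivity of `ψ` makes the numerator zero in `A`, and so its image `b * φ q` in
`K` vanishes. -/
theorem Specializes.ne_zero (hψ : Function.Injective ψ) {a : F} {b : K}
    (h : Specializes ψ φ a b) (hb : b ≠ 0) : a ≠ 0 := by
  obtain ⟨p, q, hq, h1, h2⟩ := h
  rintro rfl
  rw [zero_mul, eq_comm, map_eq_zero_iff ψ hψ] at h1
  rw [h1, map_zero] at h2
  exact mul_ne_zero hb hq h2

theorem Specializes.inv (hψ : Function.Injective ψ) {a : F} {b : K}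
    (h : Specializes ψ φ a b) (hb : b ≠ 0) : Specializes ψ φ a⁻¹ b⁻¹ := by
  have ha := h.ne_zero hψ hb
  obtain ⟨p, q, hq, h1, h2⟩ := h
  refine ⟨q, p, h2 ▸ mul_ne_zero hb hq, ?_, ?_⟩
  · rw [← h1]; field_simp
  · rw [← h2]; field_simp

/-- Specialization of the solution of a linear equation. -/
theorem Specializes.of_mul_eq (hψ : Function.Injective ψ) {a c x : F} {b d y : K}
    (h : Specializes ψ φ a b) (h' : Specializes ψ φ c d) (hd : d ≠ 0) (hx : x * c = a)
    (hy : y * d = b) : Specializes ψ φ x y := by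
  have hc := h'.ne_zero hψ hd
  have := h.mul (h'.inv hψ hd)
  rwa [← hx, ← hy, mul_inv_cancel_right₀ hc, mul_inv_cancel_right₀ hd] at this

/-- Two fractions for `a` agree after cross-multiplication already in `A`, because `ψ` is injective.
Thus an identity in the generic field passes to every field in which the denominators survive. -/
theorem Specializes.unique (hψ : Function.Injective ψ) {a : F} {b b' : K}
    (h : Specializes ψ φ a b) (h' : Specializes ψ φ a b') : b = b' := by
  obtain ⟨p, q, hq, h1, h2⟩ := h
  obtain ⟨p', q', hq', h1', h2'⟩ := h'
  have hpq : p * q' = p' * q := hψ (by simp only [map_mul, ← h1, ← h1']; ring)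
  have := congrArg φ hpq
  simp only [map_mul, ← h2, ← h2'] at this
  exact mul_right_cancel₀ (mul_ne_zero hq hq') (by linear_combination this)

theorem Specializes.pow {a : F} {b : K} (h : Specializes ψ φ a b) (n : ℕ) :
    Specializes ψ φ (a ^ n) (b ^ n) := by
  induction n with
  | zero => simpa using specializes_one
  | succ n ih => simpa [pow_succ] using ih.mul h

theorem Specializes.zpow (hψ : Function.Injective ψ) {a : F} {b : K} (h : Specializes ψ φ a b)
    (hb : b ≠ 0) (n : ℤ) : Specializes ψ φ (a ^ n) (b ^ n) := by
  cases n with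
  | ofNat n => simpa using h.pow n
  | negSucc n => simpa [zpow_negSucc] using (h.pow (n + 1)).inv hψ (pow_ne_zero _ hb)

theorem specializes_prod {J : Type*} (s : Finset J) {f : J → F} {g : J → K}
    (h : ∀ j ∈ s, Specializes ψ φ (f j) (g j)) :
    Specializes ψ φ (∏ j ∈ s, f j) (∏ j ∈ s, g j) := by
  classical
  induction s using Finset.induction_on with
  | empty => simpa using specializes_one
  | insert j s hj ih =>
    rw [Finset.prod_insert hj, Finset.prod_insert hj]
    exact (h j (by simp)).mul (ih fun i hi => h i (by simp [hi]))

theorem specializes_sum {J : Type*} (s : Finset J) {f : J → F} {g : J → K}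
    (h : ∀ j ∈ s, Specializes ψ φ (f j) (g j)) :
    Specializes ψ φ (∑ j ∈ s, f j) (∑ j ∈ s, g j) := by
  classical
  induction s using Finset.induction_on with
  | empty => simpa using specializes_zero
  | insert j s hj ih =>
    rw [Finset.sum_insert hj, Finset.sum_insert hj]
    exact (h j (by simp)).add (ih fun i hi => h i (by simp [hi]))

theorem PosLaurent.specializes_eval (hψ : Function.Injective ψ) {ι : Type*} [Fintype ι]
    (P : PosLaurent ι) {x : ι → F} {y : ι → K} (h : ∀ v, Specializes ψ φ (x v) (y v))
    (hy : ∀ v, y v ≠ 0) : Specializes ψ φ (P.eval x) (P.eval y) :=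
  specializes_sum _ fun _ _ => (specializes_natCast _).mul
    (specializes_prod _ fun v _ => (h v).zpow hψ (hy v) _)

end Specialization

/-! ### The generic solution and its non-vanishing -/

section Generic

variable {A K : Type*} [CommRing A] [Field K] {r : ℕ}

/-- Specialization to positive rational numbers propagates along the recursion. -/
theorem exists_pos_specializes {ψ : A →+* K} (hψ : Function.Injective ψ) {φ : A →+* ℚ}
    {S : ℕ → ℕ → K} (h0 : ∀ α ≤ r + 1, ∃ b > 0, Specializes ψ φ (S 0 α) b)
    (h1 : ∀ α ≤ r + 1, ∃ b > 0, Specializes ψ φ (S 1 α) b) (hl : ∀ n, S n 0 = 1)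
    (hr : ∀ n, S n (r + 1) = 1)
    (hS : ∀ n α, 1 ≤ α → α ≤ r → S n α ≠ 0 →
      S (n + 2) α * S n α = S (n + 1) α ^ 2 + S (n + 1) (α + 1) * S (n + 1) (α - 1)) (n : ℕ) :
    (∀ α ≤ r + 1, ∃ b > 0, Specializes ψ φ (S n α) b) ∧
      ∀ α ≤ r + 1, ∃ b > 0, Specializes ψ φ (S (n + 1) α) b := by
  induction n with
  | zero => exact ⟨h0, h1⟩
  | succ n ih =>
    refine ⟨ih.2, fun α hα => ?_⟩
    by_cases h : 1 ≤ α ∧ α ≤ r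
    · obtain ⟨b, hb, hbS⟩ := ih.1 α hα
      obtain ⟨c, hc, hcS⟩ := ih.2 α hα
      obtain ⟨d, hd, hdS⟩ := ih.2 (α + 1) (by omega)
      obtain ⟨e, he, heS⟩ := ih.2 (α - 1) (by omega)
      -- No subtraction occurs, so the value stays positive. Positivity of `b` also provides `S n α
      -- ≠ 0`, under which alone the recursion is assumed, as needed for a sequence defined by
      -- division.
      refine ⟨(c ^ 2 + d * e) / b, by positivity, ?_⟩
      exact ((hcS.pow 2).add (hdS.mul heS)).of_mul_eq hψ hbS hb.ne'
        (hS n α h.1 h.2 (hbS.ne_zero hψ hb.ne')) (div_mul_cancel₀ _ hb.ne')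
    · refine ⟨1, one_pos, ?_⟩
      have : S (n + 1 + 1) α = 1 := by
        rcases Nat.eq_zero_or_pos α with rfl | hpos
        · exact hl _
        · obtain rfl : α = r + 1 := by omega
          exact hr _
      rw [this]
      exact specializes_one

/-- The time reversal that exchanges the two rows of initial data. -/
theorem IsSolution.reverse {R : ℕ → ℤ → K} (hR : IsSolution r R) :
    IsSolution r fun α n => R α (1 - n) where
  rel α h1 h2 n := by
    have := hR.rel α h1 h2 (1 - n)
    rw [show 1 - n + 1 = 1 - (n - 1) by ring, show 1 - n - 1 = 1 - (n + 1) by ring] at this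
    rw [mul_comm, this]
  left n := hR.left _
  right n := hR.right _

theorem NonVanishing.reverse {R : ℕ → ℤ → K} (hnv : NonVanishing r R) :
    NonVanishing r fun α n => R α (1 - n) := fun α h1 h2 n => hnv α h1 h2 (1 - n)

theorem IsSolution.ne_zero_of_specializes {R : ℕ → ℤ → K} (hR : IsSolution r R) {ψ : A →+* K}
    (hψ : Function.Injective ψ) {φ : A →+* ℚ}
    (h0 : ∀ α ≤ r + 1, ∃ b > 0, Specializes ψ φ (R α 0) b)
    (h1 : ∀ α ≤ r + 1, ∃ b > 0, Specializes ψ φ (R α 1) b) {α : ℕ} (hα : α ≤ r + 1) (n : ℕ) :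
    R α n ≠ 0 := by
  obtain ⟨b, hb, h⟩ := (exists_pos_specializes hψ (S := fun n α => R α n) h0 h1
    (fun n => hR.left n) (fun n => hR.right n) (fun n α ha hb _ => by
      have := hR.rel α ha hb (n + 1)
      simpa [add_assoc, one_add_one_eq_two] using this) n).1 α hα
  exact h.ne_zero hψ (ne_of_gt hb)

/-- Initial data that are images of variables specialize to `1`. -/
theorem exists_pos_specializes_initial {R : ℕ → ℤ → K} {x : InitVar r → K} {α k : ℕ}
    (hx : ∀ v : InitVar r, (v.1 : ℕ) + 1 = α → (v.2 : ℕ) = k → R α k = x v) (hk : k < 2)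
    (hl : R 0 k = 1) (hr : R (r + 1) k = 1) (hα : α ≤ r + 1) :
    ∃ b > 0, Specializes (MvPolynomial.aeval x : MvPolynomial (InitVar r) ℤ →ₐ[ℤ] K).toRingHom
      (MvPolynomial.aeval fun _ => 1 : MvPolynomial (InitVar r) ℤ →ₐ[ℤ] ℚ).toRingHom (R α k) b := by
  refine ⟨1, one_pos, ?_⟩
  by_cases h : 1 ≤ α ∧ α ≤ r
  · rw [hx (⟨α - 1, by omega⟩, ⟨k, hk⟩) (by simp only; omega) rfl]
    have := specializes_map
      (ψ := (MvPolynomial.aeval x : MvPolynomial (InitVar r) ℤ →ₐ[ℤ] K).toRingHom)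
      (φ := (MvPolynomial.aeval fun _ => 1 : MvPolynomial (InitVar r) ℤ →ₐ[ℤ] ℚ).toRingHom)
      (MvPolynomial.X (⟨α - 1, by omega⟩, ⟨k, hk⟩))
    simpa using this
  · have : R α k = 1 := by
      rcases Nat.eq_zero_or_pos α with rfl | hpos
      · exact hl
      · obtain rfl : α = r + 1 := by omega
        exact hr
    rw [this]
    exact specializes_one

/-- Solutions with algebraically independent initial data are non-vanishing. -/
theorem IsSolution.nonVanishing {R : ℕ → ℤ → K} (hR : IsSolution r R)
    (hx : AlgebraicIndependent ℤ (initialData r R)) : NonVanishing r R := by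
  have hinit : ∀ k : ℕ, k < 2 → ∀ α ≤ r + 1, ∃ b > 0, Specializes
      (MvPolynomial.aeval (initialData r R) : MvPolynomial (InitVar r) ℤ →ₐ[ℤ] K).toRingHom
      (MvPolynomial.aeval fun _ => 1 : MvPolynomial (InitVar r) ℤ →ₐ[ℤ] ℚ).toRingHom (R α k) b :=
    fun k hk α hα => exists_pos_specializes_initial (by rintro v rfl rfl; rfl) hk (hR.left _)
      (hR.right _) hα
  have h0 := hinit 0 (by omega)
  have h1 := hinit 1 (by omega)
  intro α _ hα n
  rcases le_total 0 n with hn | hn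
  · obtain ⟨n, rfl⟩ := Int.eq_ofNat_of_zero_le hn
    exact hR.ne_zero_of_specializes hx h0 h1 (by omega) n
  -- Time reversal exchanges the rows at times `0` and `1`, hence the exchange of `h0` and `h1`.
  · have := hR.reverse.ne_zero_of_specializes hx (by simpa using h1) (by simpa using h0)
      (show α ≤ r + 1 by omega) (1 - n).toNat
    simpa [Int.toNat_of_nonneg (show 0 ≤ 1 - n by omega)] using this

/-- The forward recursion of the `Q`-system. -/
noncomputable def recSolution (r : ℕ) (a b : ℕ → K) : ℕ → ℕ → K
  | 0 => a
  | 1 => b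
  | n + 2 => fun α =>
    if 1 ≤ α ∧ α ≤ r then
      (recSolution r a b (n + 1) α ^ 2 +
        recSolution r a b (n + 1) (α + 1) * recSolution r a b (n + 1) (α - 1)) /
        recSolution r a b n α
    else 1

theorem recSolution_boundary {a b : ℕ → K} {α : ℕ} (hα : ¬(1 ≤ α ∧ α ≤ r)) (ha : a α = 1)
    (hb : b α = 1) (n : ℕ) : recSolution r a b n α = 1 := by
  match n with
  | 0 => exact ha
  | 1 => exact hb
  | n + 2 => exact if_neg hα

theorem recSolution_rel {a b : ℕ → K} {n α : ℕ} (h1 : 1 ≤ α) (hα : α ≤ r)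
    (h : recSolution r a b n α ≠ 0) :
    recSolution r a b (n + 2) α * recSolution r a b n α = recSolution r a b (n + 1) α ^ 2 +
      recSolution r a b (n + 1) (α + 1) * recSolution r a b (n + 1) (α - 1) := by
  have h2 : recSolution r a b (n + 2) α = (recSolution r a b (n + 1) α ^ 2 +
      recSolution r a b (n + 1) (α + 1) * recSolution r a b (n + 1) (α - 1)) /
        recSolution r a b n α := if_pos ⟨h1, hα⟩
  rw [h2, div_mul_cancel₀ _ h]

/-- The forward and the backward recursion together. -/
noncomputable def recSolutionInt (r : ℕ) (a b : ℕ → K) (α : ℕ) (n : ℤ) : K :=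
  if 0 ≤ n then recSolution r a b n.toNat α else recSolution r b a (1 - n).toNat α

theorem recSolutionInt_natCast (a b : ℕ → K) (α n : ℕ) :
    recSolutionInt r a b α n = recSolution r a b n α := by
  simp [recSolutionInt]

theorem recSolutionInt_one_sub (a b : ℕ → K) (α n : ℕ) :
    recSolutionInt r a b α (1 - n) = recSolution r b a n α := by
  match n with
  | 0 => simp [recSolutionInt, recSolution]
  | 1 => simp [recSolutionInt, recSolution]
  | n + 2 =>
    rw [recSolutionInt, if_neg (by push_cast; omega)]
    congr 1
    omega

theorem isSolution_recSolutionInt {a b : ℕ → K} (ha0 : a 0 = 1) (ha1 : a (r + 1) = 1)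
    (hb0 : b 0 = 1) (hb1 : b (r + 1) = 1)
    (hab : ∀ n α, 1 ≤ α → α ≤ r → recSolution r a b n α ≠ 0)
    (hba : ∀ n α, 1 ≤ α → α ≤ r → recSolution r b a n α ≠ 0) :
    IsSolution r (recSolutionInt r a b) where
  rel α h1 h2 n := by
    rcases le_or_gt 1 n with hn | hn
    · obtain ⟨m, rfl⟩ : ∃ m : ℕ, n = m + 1 := ⟨(n - 1).toNat, by omega⟩
      have e1 : (m + 1 + 1 : ℤ) = ((m + 2 : ℕ) : ℤ) := by push_cast; ring
      have e2 : (m + 1 - 1 : ℤ) = (m : ℤ) := by ring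
      have e3 : (m + 1 : ℤ) = ((m + 1 : ℕ) : ℤ) := by push_cast; ring
      rw [e1, e2, e3]
      simp only [recSolutionInt_natCast]
      exact recSolution_rel h1 h2 (hab m α h1 h2)
    · obtain ⟨m, rfl⟩ : ∃ m : ℕ, n = 1 - (m + 1 : ℕ) := ⟨(-n).toNat, by omega⟩
      have e1 : (1 - (m + 1 : ℕ) + 1 : ℤ) = 1 - (m : ℕ) := by push_cast; ring
      have e2 : (1 - (m + 1 : ℕ) - 1 : ℤ) = 1 - (m + 2 : ℕ) := by push_cast; ring
      rw [e1, e2]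
      simp only [recSolutionInt_one_sub]
      rw [mul_comm]
      exact recSolution_rel h1 h2 (hba m α h1 h2)
  left n := by
    unfold recSolutionInt
    split_ifs
    · exact recSolution_boundary (by omega) ha0 hb0 _
    · exact recSolution_boundary (by omega) hb0 ha0 _
  right n := by
    unfold recSolutionInt
    split_ifs
    · exact recSolution_boundary (by omega) ha1 hb1 _
    · exact recSolution_boundary (by omega) hb1 ha1 _

/-- The solution is built by division in both directions of time; positivity under the
specialization of all variables to `1` shows that no denominator vanishes. -/
theorem exists_solution {x : InitVar r → K} (hx : AlgebraicIndependent ℤ x) :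
    ∃ R : ℕ → ℤ → K, IsSolution r R ∧ initialData r R = x := by
  let c : ℕ → ℕ → K := fun k α =>
    if h : (1 ≤ α ∧ α ≤ r) ∧ k < 2 then x (⟨α - 1, by omega⟩, ⟨k, h.2⟩) else 1
  have hc0 : ∀ k, c k 0 = 1 := fun k => dif_neg (by omega)
  have hc1 : ∀ k, c k (r + 1) = 1 := fun k => dif_neg (by omega)
  have hcx : ∀ v : InitVar r, c v.2 (v.1 + 1) = x v := by
    intro v
    simp only [c]
    rw [dif_pos (by omega)]
    rfl
  have hpos : ∀ k < 2, ∀ α ≤ r + 1, ∃ b > 0, Specializes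
      (MvPolynomial.aeval x : MvPolynomial (InitVar r) ℤ →ₐ[ℤ] K).toRingHom
      (MvPolynomial.aeval fun _ => 1 : MvPolynomial (InitVar r) ℤ →ₐ[ℤ] ℚ).toRingHom (c k α) b := by
    intro k hk α hα
    have := exists_pos_specializes_initial (R := fun α k => c k.toNat α) (x := x) (k := k) (α := α)
      (by rintro v rfl rfl; simpa using hcx v) hk (hc0 _) (hc1 _) hα
    simpa using this
  have hne : ∀ k l, k < 2 → l < 2 → ∀ n α, 1 ≤ α → α ≤ r →
      recSolution r (c k) (c l) n α ≠ 0 := by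
    intro k l hk hl n α h1 h2
    obtain ⟨b, hb, h⟩ := (exists_pos_specializes hx (S := recSolution r (c k) (c l)) (hpos k hk)
      (hpos l hl) (recSolution_boundary (by omega) (hc0 _) (hc0 _))
      (recSolution_boundary (by omega) (hc1 _) (hc1 _))
      (fun n α h1 h2 h => recSolution_rel h1 h2 h) n).1 α (by omega)
    exact h.ne_zero hx hb.ne'
  refine ⟨recSolutionInt r (c 0) (c 1), isSolution_recSolutionInt (hc0 _) (hc1 _) (hc0 _) (hc1 _)
    (hne 0 1 (by omega) (by omega)) (hne 1 0 (by omega) (by omega)), ?_⟩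
  ext ⟨i, k⟩
  rw [initialData, recSolutionInt_natCast, ← hcx]
  fin_cases k <;> rfl

theorem algebraicIndependent_algebraMap_X (r : ℕ) (F : Type*) [Field F]
    [Algebra (MvPolynomial (InitVar r) ℤ) F] [IsFractionRing (MvPolynomial (InitVar r) ℤ) F] :
    AlgebraicIndependent ℤ fun v : InitVar r =>
      algebraMap (MvPolynomial (InitVar r) ℤ) F (MvPolynomial.X v) :=
  (MvPolynomial.algebraicIndependent_X (InitVar r) ℤ).map'
    (f := (algebraMap (MvPolynomial (InitVar r) ℤ) F).toIntAlgHom) (IsFractionRing.injective _ _)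

/-- The solution whose initial data are the variables. -/
theorem exists_generic_solution (r : ℕ) (F : Type*) [Field F]
    [Algebra (MvPolynomial (InitVar r) ℤ) F] [IsFractionRing (MvPolynomial (InitVar r) ℤ) F] :
    ∃ R : ℕ → ℤ → F, IsSolution r R ∧ NonVanishing r R ∧
      ∀ v, initialData r R v = algebraMap (MvPolynomial (InitVar r) ℤ) F (MvPolynomial.X v) := by
  have hX := algebraicIndependent_algebraMap_X r F
  obtain ⟨R, hR, hinit⟩ := exists_solution hX
  rw [← hinit] at hX
  exact ⟨R, hR, hR.nonVanishing hX, congrFun hinit⟩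

end Generic

/-! ### Laurent positivity for all `n` -/

section Positivity

variable {K : Type*} [Field K] {r : ℕ} {R : ℕ → ℤ → K}

/-- The inclusion of the variables of the system of rank `r - k`, shifted by `k`. -/
def shiftVar (r k : ℕ) (v : InitVar (r - k)) : InitVar r := (⟨v.1 + k, by omega⟩, v.2)

/-- Inside the light cone that misses the left boundary, the system of rank `r` is a
specialization of the generic system of rank `r - k`. -/
theorem IsSolution.specializes_shift {A F : Type*} [CommRing A] [Field F] {ψ : A →+* F}
    {φ : A →+* K} (hψ : Function.Injective ψ) (hR : IsSolution r R) (hnv : NonVanishing r R)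
    {k : ℕ} (hk : k ≤ r) {R' : ℕ → ℤ → F} (hR' : IsSolution (r - k) R')
    (hinit : ∀ v : InitVar (r - k),
      Specializes ψ φ (initialData (r - k) R' v) (initialData r R (shiftVar r k v))) (m : ℕ) :
    (∀ β, 1 ≤ β → m ≤ β → β ≤ r - k + 1 → Specializes ψ φ (R' β m) (R (β + k) m)) ∧
      ∀ β, 1 ≤ β → m + 1 ≤ β → β ≤ r - k + 1 →
        Specializes ψ φ (R' β (m + 1 : ℕ)) (R (β + k) (m + 1 : ℕ)) := by
  have hright : ∀ m : ℤ, Specializes ψ φ (R' (r - k + 1) m) (R (r - k + 1 + k) m) := by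
    intro m
    rw [hR'.right, show r - k + 1 + k = r + 1 by omega, hR.right]
    exact specializes_one
  have h01 : ∀ l : ℕ, l < 2 → ∀ β, 1 ≤ β → β ≤ r - k + 1 →
      Specializes ψ φ (R' β l) (R (β + k) l) := by
    intro l hl β h1 h2
    rcases h2.eq_or_lt with rfl | h2
    · exact hright _
    · have := hinit (⟨β - 1, by omega⟩, ⟨l, hl⟩)
      simp only [initialData, shiftVar] at this
      rwa [show β - 1 + 1 = β by omega, show β - 1 + k + 1 = β + k by omega] at this
  induction m with
  | zero => exact ⟨fun β h1 _ h2 => h01 0 (by omega) β h1 h2,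
      fun β h1 _ h2 => h01 1 (by omega) β h1 h2⟩
  | succ m ih =>
    refine ⟨ih.2, fun β h1 hmβ h2 => ?_⟩
    rcases h2.eq_or_lt with rfl | h2
    · exact hright _
    · have e1 := hR'.rel β h1 (by omega) (m + 1 : ℕ)
      have e2 := hR.rel (β + k) (by omega) (by omega) (m + 1 : ℕ)
      have c1 : ((m + 1 : ℕ) : ℤ) + 1 = (m + 1 + 1 : ℕ) := by push_cast; ring
      have c2 : ((m + 1 : ℕ) : ℤ) - 1 = (m : ℕ) := by push_cast; ring
      rw [c1, c2] at e1 e2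
      have s1 := ih.2 β h1 (by omega) (by omega)
      have s2 := ih.2 (β + 1) (by omega) (by omega) (by omega)
      -- Here `m + 2 ≤ β`, so `β - 1 ≥ m + 1 ≥ 1`: the recursion never reads row `0` of the smaller
      -- system, where its value `1` need not match `R k`.
      have s3 := ih.2 (β - 1) (by omega) (by omega) (by omega)
      rw [show β + 1 + k = β + k + 1 by omega] at s2
      rw [show β - 1 + k = β + k - 1 by omega] at s3
      exact ((s1.pow 2).add (s2.mul s3)).of_mul_eq hψ (ih.1 β h1 (by omega) (by omega))
        (hnv _ (by omega) (by omega) _) e1 e2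

/-- The generic element of rank `r - k` at `(n + 1, n)` specializes both to `R (n + 1 + k) n`, by
the light cone argument, and to the value of its path polynomial, so the two agree. -/
theorem IsSolution.eq_pathLaurent_shift_of_generic (hR : IsSolution r R) (hnv : NonVanishing r R)
    {n k : ℕ} (hk : n + 1 + k ≤ r) (F : Type*) [Field F]
    [Algebra (MvPolynomial (InitVar (r - k)) ℤ) F]
    [IsFractionRing (MvPolynomial (InitVar (r - k)) ℤ) F] :
    R (n + 1 + k) n =
      (pathLaurent (r - k) (n + 1) n).eval (initialData r R ∘ shiftVar r k) := by
  obtain ⟨R', hR', hnv', hinit⟩ := exists_generic_solution (r - k) F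
  let φ := (MvPolynomial.aeval (initialData r R ∘ shiftVar r k) :
    MvPolynomial (InitVar (r - k)) ℤ →ₐ[ℤ] K).toRingHom
  let ψ := algebraMap (MvPolynomial (InitVar (r - k)) ℤ) F
  have hψ : Function.Injective ψ := IsFractionRing.injective _ _
  have hs : ∀ v, Specializes ψ φ (initialData (r - k) R' v)
      (initialData r R (shiftVar r k v)) := by
    intro v
    have := specializes_map (ψ := ψ) (φ := φ) (MvPolynomial.X v)
    rw [hinit]
    simpa [φ] using this
  refine ((hR.specializes_shift hψ hnv (by omega) hR' hs n).1 (n + 1) (by omega) (by omega)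
    (by omega)).unique hψ ?_
  rw [hR'.eq_pathLaurent hnv' (by omega) (by omega) le_rfl]
  exact PosLaurent.specializes_eval hψ _ hs fun v => hnv.initialData_ne_zero _

theorem IsSolution.eq_pathLaurent_shift (hR : IsSolution r R) (hnv : NonVanishing r R)
    {n k : ℕ} (hk : n + 1 + k ≤ r) :
    R (n + 1 + k) n =
      (pathLaurent (r - k) (n + 1) n).eval (initialData r R ∘ shiftVar r k) :=
  hR.eq_pathLaurent_shift_of_generic hnv hk (FractionRing (MvPolynomial (InitVar (r - k)) ℤ))

/-- The Laurent polynomial that represents `R α n`, `n ≥ 0`. -/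
noncomputable def solutionLaurentNat (r α n : ℕ) : PosLaurent (InitVar r) :=
  if α ≤ n + 1 then pathLaurent r α n
  -- The shift `k = α - (n + 1)` moves row `α` to row `n + 1`, the last one for which the path
  -- formula holds at time `n`.
  else Finsupp.mapDomain (pushExponent (shiftVar r (α - (n + 1))))
    (pathLaurent (r - (α - (n + 1))) (n + 1) n)

theorem IsSolution.eq_solutionLaurentNat (hR : IsSolution r R) (hnv : NonVanishing r R) {α : ℕ}
    (h1 : 1 ≤ α) (hα : α ≤ r) (n : ℕ) :
    R α n = (solutionLaurentNat r α n).eval (initialData r R) := by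
  unfold solutionLaurentNat
  split_ifs with h
  · exact hR.eq_pathLaurent hnv (by omega) hα h
  · rw [PosLaurent.eval_mapDomain hnv.initialData_ne_zero, ← hR.eq_pathLaurent_shift hnv (by omega),
      show n + 1 + (α - (n + 1)) = α by omega]

/-- The Laurent polynomial that represents `R α n`. -/
noncomputable def solutionLaurent (r α : ℕ) (n : ℤ) : PosLaurent (InitVar r) :=
  if 0 ≤ n then solutionLaurentNat r α n.toNat
  else Finsupp.mapDomain (pushExponent fun v : InitVar r => (v.1, v.2.rev))
    (solutionLaurentNat r α (1 - n).toNat)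

theorem IsSolution.eq_solutionLaurent (hR : IsSolution r R) (hnv : NonVanishing r R) {α : ℕ}
    (h1 : 1 ≤ α) (hα : α ≤ r) (n : ℤ) :
    R α n = (solutionLaurent r α n).eval (initialData r R) := by
  unfold solutionLaurent
  split_ifs with h
  · rw [← hR.eq_solutionLaurentNat hnv h1 hα, Int.toNat_of_nonneg h]
  -- Reversing the second index of the variables gives the initial data of the time-reversed
  -- solution, in which `n < 0` becomes `1 - n > 0`.
  · have hrev : (initialData r R ∘ fun v : InitVar r => (v.1, v.2.rev)) =
        initialData r fun α n => R α (1 - n) := by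
      ext ⟨i, k⟩
      fin_cases k <;> simp [initialData]
    rw [PosLaurent.eval_mapDomain hnv.initialData_ne_zero, hrev,
      ← hR.reverse.eq_solutionLaurentNat hnv.reverse h1 hα,
      Int.toNat_of_nonneg (by omega), sub_sub_cancel]

end Positivity

end QSystem

theorem mainTheorem1 (r : ℕ) (hr : 1 ≤ r) :
    -- the solution with indeterminate initial data exists,
    (∃ R : ℕ → ℤ → FractionRing (MvPolynomial (QSystem.InitVar r) ℤ),
      QSystem.IsSolution r R ∧ ∀ v, QSystem.initialData r R v =
        algebraMap (MvPolynomial (QSystem.InitVar r) ℤ) _ (MvPolynomial.X v)) ∧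
    -- solutions with algebraically independent initial data never vanish,
    (∀ (K : Type*) [Field K] (R : ℕ → ℤ → K), QSystem.IsSolution r R →
      AlgebraicIndependent ℤ (QSystem.initialData r R) → QSystem.NonVanishing r R) ∧
    -- and every nowhere vanishing solution is given by universal expressions in its initial data
    ∃ (M : ℕ → QSystem.InitVar r → ℤ) (P : ℕ → ℤ → QSystem.PosLaurent (QSystem.InitVar r)),
      ∀ (K : Type*) [Field K] (R : ℕ → ℤ → K),
        QSystem.IsSolution r R → QSystem.NonVanishing r R →
          (∀ j : ℕ, 1 ≤ j → j ≤ 2 * r + 1 → QSystem.weight R j =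
            QSystem.laurentMonomial (M j) (QSystem.initialData r R)) ∧
          (∀ α : ℕ, 1 ≤ α → α ≤ r → ∀ n : ℕ, α ≤ n + 1 →
            R α n = R 1 0 ^ α * QSystem.pathPartition r (QSystem.weight R)
              (QSystem.startTime α) (QSystem.endTime n α)) ∧
          (∀ α : ℕ, 1 ≤ α → α ≤ r → ∀ n : ℤ,
            R α n = (P α n).eval (QSystem.initialData r R)) := by

  refine ⟨?_, fun K _ R hR hx => hR.nonVanishing hx, QSystem.weightExponent r,
    QSystem.solutionLaurent r, fun K _ R hR hnv => ⟨fun j _ hj => hR.weight_eq hnv hj,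
      fun α _ hα n hn => hR.eq_pathPartition hnv hr hα hn,
      fun α h1 hα n => hR.eq_solutionLaurent hnv h1 hα n⟩⟩
  obtain ⟨R, hR, -, hinit⟩ := QSystem.exists_generic_solution r
    (FractionRing (MvPolynomial (QSystem.InitVar r) ℤ))
  exact ⟨R, hR, hinit⟩
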